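/- Let $n\ge 0$ and $d\ge 1$ be integers and let $B^n\subset\mathbb R^n$ be the closed unit ball. For a $C^{l}$ function $f$ on $B^n$ put $M_l(f)=\max_{z\in B^n}\|f^{(l)}(z)\|$, where $\|f^{(l)}(z)\|=\sum_{i_1,\dots,i_l=1}^n|\partial_{i_1}\cdots\partial_{i_l}f(z)|$ is the sum of the absolute values of all the partial derivatives of order $l$ (so $M_0(f)=\max_{B^n}|f|$). Let $\bar C(n,d)$ be the least constant $C\ge 0$ such that $M_k(P)\le C\,M_0(P)$ for all real polynomials $P$ in $n$ variables of degree at most $d$ and all $k=1,\dots,d$. Put $$C_3=C_3(n,d)=\bar C(n,d)+\frac{\bar C(n,d)}{(d+1)!}+\frac1{(d-1)!},\qquad T(\gamma)=\min\Big\{1,\frac{d!\,\gamma^2}{4C_3}\Big\}.$$ Two sets $V,W\subset B^n$ are called $C^d$ isotopic if there is a $C^d$ map $F:[0,1]\times V\to B^n$ such that each $F_\tau=F(\tau,\cdot)$ is a $C^d$ embedding of $V$ (a $C^d$ diffeomorphism of $V$ onto $F_\tau(V)$), $F_0$ is the inclusion of $V$, and $F_1(V)=W$. (A map on an arbitrary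 subset of a Euclidean space is of class $C^d$ if locally it extends to a $C^d$ map on an open set.) **Theorem.** Let $f$ be a $C^{d+1}$ function on $B^n$ with $M_0(f)=1$ all of whose zeros in $B^n$ lie in the concentric closed ball of radius $\frac12$. Let $0<\gamma<1$ and suppose that $0$ is a $\gamma$-regular value of $f$, that is, $\|\operatorname{grad} f(x)\|\ge\gamma$ (Euclidean norm) for each $x\in B^n$ with $f(x)=0$. Suppose that the level set $Y_0(f)=\{x\in B^n: f(x)=0\}$ is not $C^d$ isotopic to any set $W$ that is a (possibly empty) union of smooth connected components of the zero set $\{P=0\}\subset\mathbb R^n$ of some real polynomial $P$ of degree at most $d$; here smooth means that $\nabla P\ne 0$ at each point of the component. Then $$M_{d+1}(f)\ \ge\ T(\gamma)=\min\Big\{1,\frac{d!\,\gamma^2}{4C_3(n,d)}\Big\}.$$ -/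

import Mathlib

open Set Metric
open scoped Nat

namespace SmoothRigidity

noncomputable section

/-- Euclidean space of dimension `n`. -/
abbrev E (n : ℕ) : Type := EuclideanSpace ℝ (Fin n)

/-- The closed unit ball `B^n`. -/
abbrev B (n : ℕ) : Set (E n) := closedBall (0 : E n) 1

/-- The norm of the `l`-th derivative of `f` at `x ∈ B^n`: the sum of the absolute values of all the
partial derivatives `∂_{i₁} ⋯ ∂_{i_l} f (x)`, over all `(i₁, …, i_l) ∈ {1, …, n}^l`.
Derivatives are taken within the closed ball, so that they make sense at its boundary. -/
def derivNorm {n : ℕ} (l : ℕ) (f : E n → ℝ) (x : E n) : ℝ :=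
  ∑ I : Fin l → Fin n,
    |iteratedFDerivWithin ℝ l f (B n) x (fun j => EuclideanSpace.single (I j) (1 : ℝ))|

/-- `M_l(f) = max_{x ∈ B^n} ‖f^{(l)}(x)‖`; the supremum is a maximum when `f` is `C^l` on `B^n`. -/
def M {n : ℕ} (l : ℕ) (f : E n → ℝ) : ℝ :=
  sSup (derivNorm l f '' B n)

/-- The level set `Y_c(f) = {x ∈ B^n : f(x) = c}`. -/
def levelSet {n : ℕ} (f : E n → ℝ) (c : ℝ) : Set (E n) :=
  {x | x ∈ B n ∧ f x = c}

/-- `c` is a `γ`-regular value of `f` on `B^n`: the Euclidean norm of the gradient of `f` is at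
least `γ` at each point of the level set of `c`. -/
def IsRegularValue {n : ℕ} (γ : ℝ) (f : E n → ℝ) (c : ℝ) : Prop :=
  ∀ x ∈ B n, f x = c → γ ≤ ‖gradientWithin f (B n) x‖

/-- The function on `ℝ^n` given by a real polynomial in `n` variables. -/
def polyFun {n : ℕ} (P : MvPolynomial (Fin n) ℝ) (x : E n) : ℝ :=
  MvPolynomial.eval (fun i => x i) P

/-- The zero set in `ℝ^n` of a polynomial. -/
def zeroSet {n : ℕ} (P : MvPolynomial (Fin n) ℝ) : Set (E n) :=
  {x | polyFun P x = 0}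

/-- `W` is a union (possibly empty) of smooth connected components of the zero set of `P`: a union
of connected components of the zero set that consists of nonsingular points (`∇P ≠ 0`). -/
def IsUnionOfSmoothComponents {n : ℕ} (P : MvPolynomial (Fin n) ℝ) (W : Set (E n)) : Prop :=
  (∃ S ⊆ zeroSet P, W = ⋃ x ∈ S, connectedComponentIn (zeroSet P) x) ∧
    ∀ x ∈ W, gradient (polyFun P) x ≠ 0

/-- The map `g`, restricted to an arbitrary subset `X` of a normed space, is of class `C^r`: near
each point of `X` it coincides on `X` with a `C^r` map defined on an open set. -/
def IsCr {V₁ V₂ : Type*} [NormedAddCommGroup V₁] [NormedSpace ℝ V₁]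
    [NormedAddCommGroup V₂] [NormedSpace ℝ V₂] (r : ℕ) (X : Set V₁) (g : V₁ → V₂) : Prop :=
  ∀ x ∈ X, ∃ U : Set V₁, IsOpen U ∧ x ∈ U ∧
    ∃ G : V₁ → V₂, ContDiffOn ℝ r G U ∧ EqOn G g (U ∩ X)

/-- `g` restricted to `X` is a `C^r` embedding: a `C^r` diffeomorphism of `X` onto its image
`g(X)`, that is, `g` is `C^r` on `X` and has an inverse `g(X) → X` of class `C^r`. -/
def IsCrEmbedding {V₁ V₂ : Type*} [NormedAddCommGroup V₁] [NormedSpace ℝ V₁]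
    [NormedAddCommGroup V₂] [NormedSpace ℝ V₂] (r : ℕ) (X : Set V₁) (g : V₁ → V₂) : Prop :=
  IsCr r X g ∧ ∃ h : V₂ → V₁, IsCr r (g '' X) h ∧ ∀ x ∈ X, h (g x) = x

/-- `V` and `W` are `C^r` isotopic in `B^n`: there is a map `(τ, x) ↦ F τ x`, of class `C^r` on
`[0,1] × V`, with values in `B^n`, each `F τ` being a `C^r` embedding of `V`, such that `F 0` is
the inclusion of `V` and `F 1` maps `V` onto `W`. -/
def AreIsotopic {n : ℕ} (r : ℕ) (V W : Set (E n)) : Prop :=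
  ∃ F : ℝ → E n → E n,
    IsCr r (Icc (0 : ℝ) 1 ×ˢ V) (fun p : ℝ × E n => F p.1 p.2) ∧
    (∀ τ ∈ Icc (0 : ℝ) 1, IsCrEmbedding r V (F τ) ∧ MapsTo (F τ) V (B n)) ∧
    (∀ x ∈ V, F 0 x = x) ∧
    F 1 '' V = W

/-- The norm-equivalence constant `C̄(n,d)`: the least constant `C ≥ 0` such that
`M_k(P) ≤ C * M_0(P)` for all polynomials `P` of degree at most `d` and all `k = 1, …, d`. -/
def Cbar (n d : ℕ) : ℝ :=
  sInf {C : ℝ | 0 ≤ C ∧ ∀ P : MvPolynomial (Fin n) ℝ, P.totalDegree ≤ d →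
    ∀ k : ℕ, 1 ≤ k → k ≤ d → M k (polyFun P) ≤ C * M 0 (polyFun P)}

/-- `C₃(n,d) = C₁ + C₂` with `C₁ = C̄(n,d)` and `C₂ = C̄(n,d)/(d+1)! + 1/(d-k+1)!` for the order
`k = 2` of the derivative; used for `d ≥ 1`. -/
def C₃ (n d : ℕ) : ℝ :=
  Cbar n d + (Cbar n d / ((d + 1)! : ℝ) + 1 / ((d - 1)! : ℝ))

/-- The threshold `T(γ) = min {1, d! γ² / (4 C₃(n,d))}`. -/
def T (n d : ℕ) (γ : ℝ) : ℝ :=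
  min 1 ((d ! : ℝ) * γ ^ 2 / (4 * C₃ n d))

end

end SmoothRigidity

/-! Suppose `M (d + 1) f < T n d γ`, and let `P` be the Taylor polynomial of `f` of degree `d` at
the centre of the ball. Taylor's estimate makes `P` close to `f` together with its gradient, while
the norm-equivalence constant for polynomials bounds the second derivative of `P`, and hence that of
`f`, by `C = C₃ n d` (`norm_iteratedFDeriv_two_le`).

The bound `C` on the Hessian controls how fast the normals of `Y_0(f)` turn. Normals of length less
than `γ / (4 * C)` at different points do not meet (`normalPoint_injective`), and they stay in the
ball because the zeros have norm at most `1/2`. Along each of them every function `f + t (P - f)`,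
`0 ≤ t ≤ 1`, is strictly increasing and changes sign, so it has exactly one zero (`exists_shift`,
`shift_unique`). Following this zero as `t` runs from `0` to `1` is the isotopy. It is of class
`C^d` by the implicit function theorem, and its inverse sends a point to the foot of its normal,
which is `C^d` by the inverse function theorem.

The final set lies in `{P = 0}`, where `∇P ≠ 0`. It is compact and relatively open there, hence a
union of connected components. This contradicts the assumption on `Y_0(f)`. -/

namespace SmoothRigidity

noncomputable section

/-! ### Symmetry of higher derivatives and Taylor's estimate in normed spaces. -/

section Calculus

open Filter Topology

variable {V F : Type*} [NormedAddCommGroup V] [NormedSpace ℝ V]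
  [NormedAddCommGroup F] [NormedSpace ℝ F]

/-- Schwarz's theorem for the second derivative of the map `iteratedFDeriv ℝ m f`. -/
theorem iteratedFDeriv_comp_swap_zero_one {f : V → F} {m : ℕ} {x : V}
    (hf : ContDiffAt ℝ (m + 2 : ℕ) f x) (v : Fin (m + 2) → V) :
    iteratedFDeriv ℝ (m + 2) f x (v ∘ Equiv.swap 0 1) = iteratedFDeriv ℝ (m + 2) f x v := by
  have hd₁ : DifferentiableAt ℝ (iteratedFDeriv ℝ (m + 1) f) x :=
    (hf.iteratedFDeriv_right (m := 1)
      (by push_cast; rw [add_comm, add_assoc]; rfl)).differentiableAt one_ne_zero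
  have hd₂ : DifferentiableAt ℝ (fderiv ℝ (iteratedFDeriv ℝ m f)) x :=
    ((hf.iteratedFDeriv_right (m := 2) (by push_cast; rw [add_comm])).fderiv_right (m := 1)
      (by rfl)).differentiableAt one_ne_zero
  have key : ∀ w : Fin (m + 2) → V, iteratedFDeriv ℝ (m + 2) f x w
      = fderiv ℝ (fderiv ℝ (iteratedFDeriv ℝ m f)) x (w 0) (w 1) (Fin.tail (Fin.tail w)) := by
    intro w
    have hA := (ContinuousMultilinearMap.apply ℝ (fun _ => V) F (Fin.tail w)).hasFDerivAt.comp x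
      hd₁.hasFDerivAt
    have hB := (ContinuousMultilinearMap.apply ℝ (fun _ => V) F
      (Fin.tail (Fin.tail w))).hasFDerivAt.comp x
      (hd₂.hasFDerivAt.clm_apply (hasFDerivAt_const (w 1) x))
    rw [iteratedFDeriv_succ_apply_left]
    refine (DFunLike.congr_fun
      (hA.unique (hB.congr_of_eventuallyEq (.of_forall fun y => ?_))) (w 0)).trans (by simp)
    exact iteratedFDeriv_succ_apply_left _
  have hsymm : IsSymmSndFDerivAt ℝ (iteratedFDeriv ℝ m f) x := by
    refine ContDiffAt.isSymmSndFDerivAt (n := 2) ?_ (by simp)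
    refine hf.iteratedFDeriv_right ?_
    push_cast
    rw [add_comm]
  rw [key, key v, hsymm.eq]
  have h0 : (v ∘ Equiv.swap 0 1) 0 = v 1 := by simp
  have h1 : (v ∘ Equiv.swap 0 1) 1 = v 0 := by simp
  rw [h0, h1]
  congr 1

/-- The iterated derivative of order `k` of a function of class `C^k` is symmetric. -/
theorem iteratedFDeriv_comp_perm {f : V → F} (k : ℕ) {x : V} (hf : ContDiffAt ℝ k f x)
    (σ : Equiv.Perm (Fin k)) (v : Fin k → V) :
    iteratedFDeriv ℝ k f x (v ∘ σ) = iteratedFDeriv ℝ k f x v := by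
  induction k generalizing x with
  | zero => congr 1; exact Subsingleton.elim _ _
  | succ k ih =>
    -- Adjacent transpositions generate. The swap of `0` and `1` is the previous lemma; any other
    -- fixes the first slot, so its case follows by differentiating the symmetry of order one less,
    -- valid near `x`.
    have hσ : σ ∈ Submonoid.closure (range fun i : Fin k => Equiv.swap i.castSucc i.succ) := by
      rw [Equiv.Perm.mclosure_swap_castSucc_succ]; trivial
    induction hσ using Submonoid.closure_induction generalizing v with
    | one => rfl
    | mul τ τ' _ _ h h' =>
      have : v ∘ ⇑(τ * τ') = (v ∘ τ) ∘ τ' := rfl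
      rw [this, h', h]
    | mem τ hτ =>
      obtain ⟨i, rfl⟩ := hτ
      cases k with
      | zero => exact i.elim0
      | succ m =>
        refine Fin.cases ?_ (fun j => ?_) i
        · exact iteratedFDeriv_comp_swap_zero_one hf v
        · have hev : ∀ᶠ y in 𝓝 x, ContDiffAt ℝ (m + 1 : ℕ) f y :=
            (hf.of_le (by exact_mod_cast Nat.le_succ _)).eventually (by simp)
          have hd : DifferentiableAt ℝ (iteratedFDeriv ℝ (m + 1) f) x :=
            (hf.iteratedFDeriv_right (m := 1)
              (by push_cast; rw [add_comm])).differentiableAt one_ne_zero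
          have happ : ∀ w : Fin (m + 1) → V, HasFDerivAt (fun y => iteratedFDeriv ℝ (m + 1) f y w)
              ((ContinuousMultilinearMap.apply ℝ (fun _ => V) F w).comp
                (fderiv ℝ (iteratedFDeriv ℝ (m + 1) f) x)) x := fun w =>
            (ContinuousMultilinearMap.apply ℝ (fun _ => V) F w).hasFDerivAt.comp x hd.hasFDerivAt
          let s := Equiv.swap j.castSucc j.succ
          have heq := (happ (Fin.tail v ∘ s)).unique ((happ (Fin.tail v)).congr_of_eventuallyEq
            (hev.mono fun y hy => ih hy s (Fin.tail v)))
          rw [iteratedFDeriv_succ_apply_left, iteratedFDeriv_succ_apply_left]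
          have h0 : (v ∘ Equiv.swap j.succ.castSucc j.succ.succ) 0 = v 0 := by
            simp only [Function.comp_apply]
            rw [Equiv.swap_apply_of_ne_of_ne]
            · simp [Fin.ext_iff]
            · simp [Fin.ext_iff]
          have ht : Fin.tail (v ∘ Equiv.swap j.succ.castSucc j.succ.succ) = Fin.tail v ∘ s := by
            funext l
            simp only [Fin.tail, Function.comp_apply, s]
            congr 1
            have := (Fin.succ_injective (m + 1)).swap_apply j.castSucc j.succ l
            rw [← this]; rfl
          rw [h0, ht]
          exact DFunLike.congr_fun heq (v 0)

/-- The Taylor series at `0`, truncated after the terms of degree `d`. -/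
def taylorSeries (f : V → F) (d : ℕ) : FormalMultilinearSeries ℝ V F := fun k =>
  if k ≤ d then (k ! : ℝ)⁻¹ • iteratedFDeriv ℝ k f 0 else 0

/-- The Taylor polynomial of degree `d` at `0`. -/
def taylorPoly (f : V → F) (d : ℕ) : V → F := (taylorSeries f d).sum

theorem hasFiniteFPowerSeriesOnBall_taylorPoly (f : V → F) (d : ℕ) :
    HasFiniteFPowerSeriesOnBall (taylorPoly f d) (taylorSeries f d) 0 (d + 1) ⊤ :=
  FormalMultilinearSeries.hasFiniteFPowerSeriesOnBall_of_finite _ fun m hm => by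
    simp [taylorSeries, Nat.not_le.2 (Nat.lt_of_succ_le hm)]

theorem taylorPoly_eq_sum (f : V → F) (d : ℕ) (x : V) :
    taylorPoly f d x
      = ∑ k ∈ Finset.range (d + 1), (k ! : ℝ)⁻¹ • iteratedFDeriv ℝ k f 0 (fun _ => x) := by
  have h := (hasFiniteFPowerSeriesOnBall_taylorPoly f d).eq_partialSum x (by simp) (d + 1) le_rfl
  rw [zero_add] at h
  rw [h, FormalMultilinearSeries.partialSum]
  refine Finset.sum_congr rfl fun k hk => ?_
  have : k ≤ d := Nat.lt_succ_iff.1 (Finset.mem_range.1 hk)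
  simp [taylorSeries, this]

theorem contDiff_taylorPoly [CompleteSpace F] (f : V → F) (d : ℕ) {m : WithTop ℕ∞} :
    ContDiff ℝ m (taylorPoly f d) := by
  rw [contDiff_iff_contDiffAt]
  intro x
  have h := (hasFiniteFPowerSeriesOnBall_taylorPoly f d).changeOrigin (y := x) (by simp)
  rw [zero_add] at h
  exact h.toHasFPowerSeriesOnBall.analyticAt.contDiffAt

/-- The derivative of a power series sums its coefficient over all permutations of the arguments; by
symmetry the `k !` terms agree and cancel the factor `(k !)⁻¹`. -/
theorem iteratedFDeriv_taylorPoly_zero [CompleteSpace F] {f : V → F} {d k : ℕ} (hk : k ≤ d)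
    (hf : ContDiffAt ℝ k f 0) :
    iteratedFDeriv ℝ k (taylorPoly f d) 0 = iteratedFDeriv ℝ k f 0 := by
  ext v
  rw [(hasFiniteFPowerSeriesOnBall_taylorPoly
    f d).toHasFPowerSeriesOnBall.iteratedFDeriv_eq_sum_of_completeSpace]
  have : ∀ σ : Equiv.Perm (Fin k), taylorSeries f d k (fun i => v (σ i))
      = (k ! : ℝ)⁻¹ • iteratedFDeriv ℝ k f 0 v := by
    intro σ
    simp only [taylorSeries, if_pos hk, smul_apply]
    congr 1
    exact iteratedFDeriv_comp_perm k hf σ v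
  rw [Finset.sum_congr rfl fun σ _ => this σ, Finset.sum_const, Finset.card_univ,
    Fintype.card_perm, Fintype.card_fin, ← Nat.cast_smul_eq_nsmul ℝ, smul_smul,
    mul_inv_cancel₀ (by positivity), one_smul]

/-- Re-expanded at `x`, the series still has no term of order above `d`. -/
theorem iteratedFDeriv_succ_taylorPoly [CompleteSpace F] (f : V → F) (d : ℕ) (x : V) :
    iteratedFDeriv ℝ (d + 1) (taylorPoly f d) x = 0 := by
  ext v
  have h := (hasFiniteFPowerSeriesOnBall_taylorPoly f d).changeOrigin (y := x) (by simp)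
  rw [zero_add] at h
  rw [h.toHasFPowerSeriesOnBall.iteratedFDeriv_eq_sum_of_completeSpace]
  simp [h.finite (d + 1) le_rfl]

/-- One integration in Taylor's estimate, done by comparing `‖g (t • x)‖` with a multiple of `t ^ (m
+ 1)` on `[0, 1]`; no integral is needed. -/
theorem norm_le_of_norm_fderiv_le_pow {g : V → F} {K : ℝ} {m : ℕ}
    (hg : ∀ x ∈ ball (0 : V) 1, DifferentiableAt ℝ g x) (h0 : g 0 = 0)
    (hb : ∀ x ∈ ball (0 : V) 1, ‖fderiv ℝ g x‖ ≤ K * ‖x‖ ^ m / m !) {x : V}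
    (hx : x ∈ ball (0 : V) 1) : ‖g x‖ ≤ K * ‖x‖ ^ (m + 1) / (m + 1)! := by
  have hmem : ∀ t ∈ Icc (0 : ℝ) 1, t • x ∈ ball (0 : V) 1 := by
    intro t ht
    rw [mem_ball_zero_iff, norm_smul, Real.norm_of_nonneg ht.1]
    rw [mem_ball_zero_iff] at hx
    nlinarith [ht.2, ht.1, norm_nonneg x]
  have hder : ∀ t ∈ Icc (0 : ℝ) 1,
      HasDerivAt (fun t : ℝ => g (t • x)) (fderiv ℝ g (t • x) x) t := by
    intro t ht
    have h2 : HasDerivAt (fun t : ℝ => t • x) x t := by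
      simpa using (hasDerivAt_id t).smul_const x
    exact (hg _ (hmem t ht)).hasFDerivAt.comp_hasDerivAt t h2
  have hB : ∀ t : ℝ, HasDerivAt (fun t : ℝ => K * ‖x‖ ^ (m + 1) / (m + 1)! * t ^ (m + 1))
      (K * ‖x‖ ^ (m + 1) / m ! * t ^ m) t := by
    intro t
    have := (hasDerivAt_pow (m + 1) t).const_mul (K * ‖x‖ ^ (m + 1) / (m + 1)!)
    refine this.congr_deriv ?_
    rw [Nat.factorial_succ]
    push_cast
    have : (m ! : ℝ) ≠ 0 := by positivity
    have : (m : ℝ) + 1 ≠ 0 := by positivity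
    field_simp
  have := image_norm_le_of_norm_deriv_right_le_deriv_boundary
    (f := fun t : ℝ => g (t • x)) (a := 0) (b := 1)
    (fun t ht => (hder t ht).continuousAt.continuousWithinAt)
    (fun t ht => (hder t (Ico_subset_Icc_self ht)).hasDerivWithinAt)
    (B := fun t : ℝ => K * ‖x‖ ^ (m + 1) / (m + 1)! * t ^ (m + 1))
    (B' := fun t : ℝ => K * ‖x‖ ^ (m + 1) / m ! * t ^ m)
    (by simp [h0]) hB (fun t ht => ?_) (right_mem_Icc.2 zero_le_one)
  · simpa using this
  · refine (ContinuousLinearMap.le_opNorm _ _).trans ?_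
    have h1 := hb _ (hmem t (Ico_subset_Icc_self ht))
    rw [norm_smul, Real.norm_of_nonneg ht.1] at h1
    refine (mul_le_mul_of_nonneg_right h1 (norm_nonneg x)).trans (le_of_eq ?_)
    ring

/-- Taylor's estimate of all derivatives of a function whose derivatives of order `≤ d`
vanish at the centre of the unit ball. -/
theorem norm_iteratedFDeriv_le_of_vanishing {g : V → F} {K : ℝ} {d : ℕ}
    (hg : ∀ x ∈ ball (0 : V) 1, ContDiffAt ℝ (d + 1 : ℕ) g x)
    (h0 : ∀ k ≤ d, iteratedFDeriv ℝ k g 0 = 0)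
    (hK : ∀ x ∈ ball (0 : V) 1, ‖iteratedFDeriv ℝ (d + 1) g x‖ ≤ K) (m k : ℕ)
    (hmk : k + m = d + 1) {x : V} (hx : x ∈ ball (0 : V) 1) :
    ‖iteratedFDeriv ℝ k g x‖ ≤ K * ‖x‖ ^ m / m ! := by
  induction m generalizing k x with
  | zero =>
    obtain rfl : k = d + 1 := by omega
    simpa using hK x hx
  | succ m ih =>
    refine norm_le_of_norm_fderiv_le_pow (fun y hy => ?_) (h0 k (by omega)) (fun y hy => ?_) hx
    · refine ((hg y hy).iteratedFDeriv_right (m := 1) ?_).differentiableAt one_ne_zero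
      have : 1 + k ≤ d + 1 := by omega
      exact_mod_cast this
    · rw [norm_fderiv_iteratedFDeriv]
      exact ih (k + 1) (by omega) hy

/-- Taylor's estimate: the derivative of order `k` of the remainder of order `d`. -/
theorem norm_iteratedFDeriv_sub_taylorPoly_le [CompleteSpace F] {f : V → F} {K : ℝ} {d : ℕ}
    (hf : ∀ x ∈ ball (0 : V) 1, ContDiffAt ℝ (d + 1 : ℕ) f x) (hK₀ : 0 ≤ K)
    (hK : ∀ x ∈ ball (0 : V) 1, ‖iteratedFDeriv ℝ (d + 1) f x‖ ≤ K) (k : ℕ) (hk : k ≤ d + 1)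
    {x : V} (hx : x ∈ ball (0 : V) 1) :
    ‖iteratedFDeriv ℝ k (f - taylorPoly f d) x‖ ≤ K / (d + 1 - k)! := by
  have h0 : (0 : V) ∈ ball (0 : V) 1 := mem_ball_self one_pos
  have hle : ∀ {j : ℕ}, j ≤ d + 1 → ((j : ℕ) : WithTop ℕ∞) ≤ ((d + 1 : ℕ) : WithTop ℕ∞) :=
    fun h => by exact_mod_cast h
  have h := norm_iteratedFDeriv_le_of_vanishing (g := f - taylorPoly f d) (K := K) (d := d)
    (fun y hy => (hf y hy).sub (contDiff_taylorPoly f d).contDiffAt)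
    (fun j hj => by
      have hj' := (hf 0 h0).of_le (hle (Nat.le_succ_of_le hj))
      rw [iteratedFDeriv_sub_apply hj' (contDiff_taylorPoly f d).contDiffAt,
        iteratedFDeriv_taylorPoly_zero hj hj', sub_self])
    (fun y hy => by
      rw [iteratedFDeriv_sub_apply (hf y hy) (contDiff_taylorPoly f d).contDiffAt,
        iteratedFDeriv_succ_taylorPoly, sub_zero]
      exact hK y hy)
    (d + 1 - k) k (by omega) hx
  refine h.trans ?_
  gcongr
  exact mul_le_of_le_one_right hK₀
    (pow_le_one₀ (norm_nonneg _) (mem_ball_zero_iff.1 hx).le)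

end Calculus

/-! ### Comparison of `derivNorm` and `M` with operator norms. -/

section Norms

variable {n : ℕ}

theorem uniqueDiffOn_B : UniqueDiffOn ℝ (B n) := by
  refine uniqueDiffOn_convex (convex_closedBall _ _) ?_
  rw [interior_closedBall _ one_ne_zero]
  exact ⟨0, mem_ball_self one_pos⟩

theorem zero_mem_B : (0 : E n) ∈ B n := mem_closedBall_self zero_le_one

theorem derivNorm_nonneg (l : ℕ) (f : E n → ℝ) (x : E n) : 0 ≤ derivNorm l f x :=
  Finset.sum_nonneg fun _ _ => abs_nonneg _

theorem derivNorm_zero (f : E n → ℝ) (x : E n) : derivNorm 0 f x = |f x| := by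
  simp [derivNorm]

theorem continuousOn_derivNorm {l : ℕ} {f : E n → ℝ} (hf : ContDiffOn ℝ l f (B n)) :
    ContinuousOn (derivNorm l f) (B n) := by
  have h := hf.continuousOn_iteratedFDerivWithin (m := l) le_rfl uniqueDiffOn_B
  refine continuousOn_finsetSum _ fun I _ => ?_
  refine ContinuousOn.abs ?_
  exact (ContinuousMultilinearMap.apply ℝ (fun _ : Fin l => E n) ℝ
    (fun j => EuclideanSpace.single (I j) (1 : ℝ))).continuous.comp_continuousOn h

theorem derivNorm_le_M {l : ℕ} {f : E n → ℝ} (hf : ContDiffOn ℝ l f (B n)) {x : E n}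
    (hx : x ∈ B n) : derivNorm l f x ≤ M l f :=
  le_csSup ((isCompact_closedBall _ _).image_of_continuousOn (continuousOn_derivNorm hf)).bddAbove
    (mem_image_of_mem _ hx)

theorem M_le {l : ℕ} {f : E n → ℝ} {c : ℝ} (h : ∀ x ∈ B n, derivNorm l f x ≤ c) : M l f ≤ c :=
  csSup_le ⟨_, mem_image_of_mem _ zero_mem_B⟩ (forall_mem_image.2 h)

theorem M_nonneg (l : ℕ) (f : E n → ℝ) : 0 ≤ M l f :=
  Real.sSup_nonneg (forall_mem_image.2 fun x _ => derivNorm_nonneg l f x)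

/-- Expand each argument in the standard basis; its coordinates are bounded by its norm. Thus bounds
on `M` give bounds on operator norms with no loss of constant. -/
theorem norm_multilinear_le_sum {l : ℕ} (A : ContinuousMultilinearMap ℝ (fun _ : Fin l => E n) ℝ) :
    ‖A‖ ≤ ∑ I : Fin l → Fin n, |A (fun j => EuclideanSpace.single (I j) (1 : ℝ))| := by
  refine A.opNorm_le_bound (Finset.sum_nonneg fun _ _ => abs_nonneg _) fun v => ?_
  have hv : v = fun j => ∑ i, v j i • EuclideanSpace.single i (1 : ℝ) := by
    funext j
    ext i
    simp [Pi.single_apply]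
  have hA : A v = ∑ I : Fin l → Fin n,
      (∏ j, v j (I j)) * A (fun j => EuclideanSpace.single (I j) (1 : ℝ)) := by
    conv_lhs => rw [hv]
    rw [A.map_sum]
    exact Finset.sum_congr rfl fun I _ => A.map_smul_univ _ _
  rw [hA, Finset.sum_mul]
  refine (norm_sum_le _ _).trans (Finset.sum_le_sum fun I _ => ?_)
  rw [norm_mul, mul_comm, norm_prod, Real.norm_eq_abs (A _)]
  refine mul_le_mul_of_nonneg_left ?_ (abs_nonneg _)
  exact Finset.prod_le_prod (fun _ _ => norm_nonneg _) fun j _ => PiLp.norm_apply_le (v j) (I j)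

theorem norm_iteratedFDerivWithin_le_derivNorm (l : ℕ) (f : E n → ℝ) (x : E n) :
    ‖iteratedFDerivWithin ℝ l f (B n) x‖ ≤ derivNorm l f x :=
  norm_multilinear_le_sum _

theorem norm_iteratedFDeriv_le_M {l : ℕ} {f : E n → ℝ} (hf : ContDiffOn ℝ l f (B n)) {x : E n}
    (hx : x ∈ ball (0 : E n) 1) : ‖iteratedFDeriv ℝ l f x‖ ≤ M l f := by
  have hx' := ball_subset_closedBall hx
  rw [← iteratedFDerivWithin_eq_iteratedFDeriv uniqueDiffOn_B
    (hf.contDiffAt (closedBall_mem_nhds_of_mem hx)) hx']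
  exact (norm_iteratedFDerivWithin_le_derivNorm _ _ _).trans (derivNorm_le_M hf hx')

theorem derivNorm_le (l : ℕ) (f : E n → ℝ) (x : E n) :
    derivNorm l f x
      ≤ Fintype.card (Fin l → Fin n) * ‖iteratedFDerivWithin ℝ l f (B n) x‖ := by
  rw [derivNorm, ← nsmul_eq_mul]
  refine Finset.sum_le_card_nsmul (Finset.univ : Finset (Fin l → Fin n)) _ _ fun I _ => ?_
  refine ((iteratedFDerivWithin ℝ l f (B n) x).le_opNorm _).trans ?_
  simp

end Norms

/-! ### Taylor polynomials as elements of `MvPolynomial`, and the constant `Cbar`. -/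

section Polynomials

variable {n : ℕ}

theorem contDiff_polyFun (P : MvPolynomial (Fin n) ℝ) {m : WithTop ℕ∞} :
    ContDiff ℝ m (polyFun P) := by
  induction P using MvPolynomial.induction_on with
  | C a =>
    have : polyFun (n := n) (MvPolynomial.C a) = fun _ => a := by funext x; simp [polyFun]
    rw [this]; exact contDiff_const
  | add p q hp hq =>
    have : polyFun (p + q) = fun x => polyFun p x + polyFun q x := by funext x; simp [polyFun]
    rw [this]; exact hp.add hq
  | mul_X p i hp =>
    have : polyFun (p * MvPolynomial.X i) = fun x => polyFun p x * x i := by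
      funext x; simp [polyFun]
    rw [this]; exact hp.mul (contDiff_euclidean.1 contDiff_id i)

/-- A continuous multilinear form restricted to the diagonal is a polynomial. -/
theorem exists_polyFun_eq_diagonal {k : ℕ}
    (A : ContinuousMultilinearMap ℝ (fun _ : Fin k => E n) ℝ) :
    ∃ P : MvPolynomial (Fin n) ℝ, P.totalDegree ≤ k ∧ ∀ x, polyFun P x = A (fun _ => x) := by
  refine ⟨∑ I : Fin k → Fin n, (∏ j, MvPolynomial.X (I j)) *
    MvPolynomial.C (A (fun j => EuclideanSpace.single (I j) (1 : ℝ))), ?_, fun x => ?_⟩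
  · refine MvPolynomial.totalDegree_finsetSum_le fun I _ => ?_
    refine (MvPolynomial.totalDegree_mul _ _).trans ?_
    rw [MvPolynomial.totalDegree_C, add_zero]
    refine (MvPolynomial.totalDegree_finsetProd _ _).trans ?_
    simp
  · have hv : x = ∑ i, x i • EuclideanSpace.single i (1 : ℝ) := by
      ext i
      simp [Pi.single_apply]
    conv_rhs => rw [hv]
    rw [A.map_sum, polyFun, map_sum]
    refine Finset.sum_congr rfl fun I _ => ?_
    rw [A.map_smul_univ]
    simp

theorem exists_polyFun_eq_taylorPoly (f : E n → ℝ) (d : ℕ) :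
    ∃ P : MvPolynomial (Fin n) ℝ, P.totalDegree ≤ d ∧ polyFun P = taylorPoly f d := by
  choose Q hQ hQ' using fun k => exists_polyFun_eq_diagonal (iteratedFDeriv ℝ k f (0 : E n))
  refine ⟨∑ k ∈ Finset.range (d + 1), (k ! : ℝ)⁻¹ • Q k, ?_, ?_⟩
  · refine MvPolynomial.totalDegree_finsetSum_le fun k hk => ?_
    exact (MvPolynomial.totalDegree_smul_le _ _).trans
      ((hQ k).trans (Nat.lt_succ_iff.1 (Finset.mem_range.1 hk)))
  · funext x
    rw [taylorPoly_eq_sum, polyFun, map_sum]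
    refine Finset.sum_congr rfl fun k _ => ?_
    rw [MvPolynomial.smul_eval, smul_eq_mul, ← hQ']
    rfl

/-- `S` factors through the finite-dimensional range of `L`, and a linear map from there is bounded.
-/
theorem exists_norm_le_of_ker_le {V X Y : Type*} [AddCommGroup V] [Module ℝ V]
    [FiniteDimensional ℝ V] [NormedAddCommGroup X] [NormedSpace ℝ X]
    [NormedAddCommGroup Y] [NormedSpace ℝ Y] (L : V →ₗ[ℝ] X) (S : V →ₗ[ℝ] Y)
    (h : ∀ v, L v = 0 → S v = 0) : ∃ C, 0 ≤ C ∧ ∀ v, ‖S v‖ ≤ C * ‖L v‖ := by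
  obtain ⟨g, hg⟩ := L.rangeRestrict.exists_rightInverse_of_surjective L.range_rangeRestrict
  let R : LinearMap.range L →L[ℝ] Y := (S.comp g).toContinuousLinearMap
  refine ⟨‖R‖, R.opNorm_nonneg, fun v => ?_⟩
  have h1 : S v = R (L.rangeRestrict v) := by
    have h2 : L (g (L.rangeRestrict v) - v) = 0 := by
      have := congrArg Subtype.val (LinearMap.congr_fun hg (L.rangeRestrict v))
      simpa [sub_eq_zero] using this
    have h3 := h _ h2
    rw [map_sub, sub_eq_zero] at h3
    exact h3.symm
  rw [h1]
  exact R.le_opNorm _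

/-- The restrictions to the ball of the derivatives of order `k` of polynomials. -/
def ballDeriv (n k : ℕ) :
    MvPolynomial (Fin n) ℝ →ₗ[ℝ] C(B n, ContinuousMultilinearMap ℝ (fun _ : Fin k => E n) ℝ) where
  toFun P := ⟨fun x => iteratedFDerivWithin ℝ k (polyFun P) (B n) x,
    ((contDiff_polyFun P).contDiffOn.continuousOn_iteratedFDerivWithin (n := k) le_rfl
      uniqueDiffOn_B).domRestrict⟩
  map_add' P Q := by
    ext1 x
    have : polyFun (P + Q) = polyFun P + polyFun Q := by funext y; simp [polyFun]
    simp only [ContinuousMap.coe_mk, ContinuousMap.add_apply, this]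
    exact iteratedFDerivWithin_add_apply (contDiff_polyFun P).contDiffWithinAt
      (contDiff_polyFun Q).contDiffWithinAt uniqueDiffOn_B x.2
  map_smul' c P := by
    ext1 x
    have : polyFun (c • P) = c • polyFun P := by funext y; simp [polyFun]
    simp only [ContinuousMap.coe_mk, ContinuousMap.smul_apply, this]
    exact iteratedFDerivWithin_const_smul_apply (contDiff_polyFun P).contDiffWithinAt
      uniqueDiffOn_B x.2

theorem ballDeriv_apply (k : ℕ) (P : MvPolynomial (Fin n) ℝ) (x : B n) :
    ballDeriv n k P x = iteratedFDerivWithin ℝ k (polyFun P) (B n) x := rfl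

/-- The kernel condition is immediate: a polynomial that vanishes on the ball has zero derivatives
within the ball, so it need not be shown to be the zero polynomial. -/
theorem exists_M_le_M_zero (n d k : ℕ) : ∃ C : ℝ, 0 ≤ C ∧ ∀ P : MvPolynomial (Fin n) ℝ,
    P.totalDegree ≤ d → M k (polyFun P) ≤ C * M 0 (polyFun P) := by
  have hker : ∀ P : MvPolynomial.restrictTotalDegree (Fin n) ℝ d,
      (ballDeriv n 0).domRestrict _ P = 0 → (ballDeriv n k).domRestrict _ P = 0 := by
    intro P hP
    ext1 x
    have h0 : ∀ y ∈ B n, polyFun (P : MvPolynomial (Fin n) ℝ) y = (fun _ => (0 : ℝ)) y := by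
      intro y hy
      have := DFunLike.congr_fun (DFunLike.congr_fun hP ⟨y, hy⟩) 0
      simpa [ballDeriv_apply] using this
    simp only [LinearMap.domRestrict_apply, ballDeriv_apply]
    rw [iteratedFDerivWithin_congr h0 x.2]
    simp
  obtain ⟨C, hC, h⟩ := exists_norm_le_of_ker_le
    (V := MvPolynomial.restrictTotalDegree (Fin n) ℝ d)
    (X := C(B n, ContinuousMultilinearMap ℝ (fun _ : Fin 0 => E n) ℝ))
    (Y := C(B n, ContinuousMultilinearMap ℝ (fun _ : Fin k => E n) ℝ))
    ((ballDeriv n 0).domRestrict (MvPolynomial.restrictTotalDegree (Fin n) ℝ d))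
    ((ballDeriv n k).domRestrict (MvPolynomial.restrictTotalDegree (Fin n) ℝ d)) hker
  refine ⟨Fintype.card (Fin k → Fin n) * C, by positivity, fun P hP => M_le fun x hx => ?_⟩
  have h1 := h ⟨P, (MvPolynomial.mem_restrictTotalDegree _ _ _).2 hP⟩
  simp only [LinearMap.domRestrict_apply] at h1
  have h2 : ‖ballDeriv n 0 P‖ ≤ M 0 (polyFun P) := by
    refine (ContinuousMap.norm_le _ (M_nonneg _ _)).2 fun y => ?_
    exact (norm_iteratedFDerivWithin_le_derivNorm _ _ _).trans
      (derivNorm_le_M (contDiff_polyFun P).contDiffOn y.2)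
  have h3 := (ballDeriv n k P).norm_coe_le_norm ⟨x, hx⟩
  rw [ballDeriv_apply] at h3
  refine (derivNorm_le k _ x).trans ?_
  rw [mul_assoc]
  gcongr
  exact h3.trans (h1.trans (by gcongr))

/-- The set of admissible constants in the definition of `Cbar`. -/
def markovConstants (n d : ℕ) : Set ℝ :=
  {C : ℝ | 0 ≤ C ∧ ∀ P : MvPolynomial (Fin n) ℝ, P.totalDegree ≤ d →
    ∀ k : ℕ, 1 ≤ k → k ≤ d → M k (polyFun P) ≤ C * M 0 (polyFun P)}

theorem Cbar_eq (n d : ℕ) : Cbar n d = sInf (markovConstants n d) := rfl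

theorem markovConstants_nonempty (n d : ℕ) : (markovConstants n d).Nonempty := by
  choose C hC h using exists_M_le_M_zero n d
  refine ⟨∑ k ∈ Finset.range (d + 1), C k, Finset.sum_nonneg fun k _ => hC k, ?_⟩
  intro P hP k _ hk
  refine (h k P hP).trans (mul_le_mul_of_nonneg_right ?_ (M_nonneg _ _))
  exact Finset.single_le_sum (f := C) (fun k _ => hC k) (Finset.mem_range.2 (Nat.lt_succ_of_le hk))

theorem M_polyFun_le {d k : ℕ} {P : MvPolynomial (Fin n) ℝ} (hP : P.totalDegree ≤ d) (hk : 1 ≤ k)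
    (hk' : k ≤ d) : M k (polyFun P) ≤ Cbar n d * M 0 (polyFun P) := by
  -- The infimum is attained: divide by `M 0` when it is positive; otherwise any admissible constant
  -- forces `M k = 0`.
  rcases (M_nonneg 0 (polyFun P)).eq_or_lt with h0 | h0
  · obtain ⟨C, hC⟩ := markovConstants_nonempty n d
    have := hC.2 P hP k hk hk'
    rwa [← h0, mul_zero] at this ⊢
  · rw [← div_le_iff₀ h0, Cbar_eq]
    refine le_csInf (markovConstants_nonempty n d) fun C hC => ?_
    rw [div_le_iff₀ h0]
    exact hC.2 P hP k hk hk'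

/-- Tested on a coordinate function. This gives `1 ≤ C₃`, which keeps the tube of radius `γ / (4 *
C₃)` thin. -/
theorem one_le_Cbar {d : ℕ} (hn : n ≠ 0) (hd : 1 ≤ d) : 1 ≤ Cbar n d := by
  obtain ⟨m, rfl⟩ := Nat.exists_eq_succ_of_ne_zero hn
  refine le_csInf (markovConstants_nonempty _ d) fun C hC => ?_
  have h := hC.2 (MvPolynomial.X 0) (by simpa using hd) 1 le_rfl hd
  have hX : polyFun (n := m + 1) (MvPolynomial.X 0) = EuclideanSpace.proj (𝕜 := ℝ) 0 := by
    funext x; simp [polyFun]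
  have h0 : M 0 (polyFun (n := m + 1) (MvPolynomial.X 0)) ≤ 1 := by
    refine M_le fun x hx => ?_
    rw [derivNorm_zero, hX]
    exact (PiLp.norm_apply_le x 0).trans (mem_closedBall_zero_iff.1 hx)
  have h1 : 1 ≤ M 1 (polyFun (n := m + 1) (MvPolynomial.X 0)) := by
    refine le_trans ?_ (derivNorm_le_M (contDiff_polyFun _).contDiffOn zero_mem_B)
    refine le_trans ?_ (Finset.single_le_sum (fun _ _ => abs_nonneg _)
      (Finset.mem_univ (fun _ => (0 : Fin (m + 1)))))
    rw [iteratedFDerivWithin_one_apply (uniqueDiffOn_B _ zero_mem_B), hX,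
      ContinuousLinearMap.fderivWithin _ (uniqueDiffOn_B _ zero_mem_B)]
    simp
  calc 1 ≤ C * M 0 (polyFun (n := m + 1) (MvPolynomial.X 0)) := h1.trans h
    _ ≤ C * 1 := mul_le_mul_of_nonneg_left h0 hC.1
    _ = C := mul_one C

end Polynomials

/-! ### Geometry of the normals to the zero set. -/

section Isotopy

open Filter Topology
open scoped Gradient RealInnerProductSpace

theorem isCr_of_contDiffAt {V₁ V₂ : Type*} [NormedAddCommGroup V₁] [NormedSpace ℝ V₁]
    [NormedAddCommGroup V₂] [NormedSpace ℝ V₂] {r : ℕ} {X : Set V₁} {g : V₁ → V₂}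
    (h : ∀ x ∈ X, ∃ G : V₁ → V₂, ContDiffAt ℝ r G x ∧ ∀ᶠ y in 𝓝 x, y ∈ X → G y = g y) :
    IsCr r X g := by
  intro x hx
  obtain ⟨G, hG, hGg⟩ := h x hx
  obtain ⟨U, hU, hUo, hxU⟩ := _root_.eventually_nhds_iff.1 ((hG.eventually (by simp)).and hGg)
  exact ⟨U, hUo, hxU, G, fun y hy => (hU y hy).1.contDiffWithinAt, fun y hy => (hU y hy.1).2 hy.2⟩

theorem IsCr.continuousOn {V₁ V₂ : Type*} [NormedAddCommGroup V₁] [NormedSpace ℝ V₁]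
    [NormedAddCommGroup V₂] [NormedSpace ℝ V₂] {r : ℕ} {X : Set V₁} {g : V₁ → V₂}
    (h : IsCr r X g) : ContinuousOn g X := by
  intro x hx
  obtain ⟨U, hU, hxU, G, hG, hGg⟩ := h x hx
  have h1 : ContinuousWithinAt G (U ∩ X) x := (hG.continuousOn x hxU).mono inter_subset_left
  exact (h1.congr (fun y hy => (hGg hy).symm) (hGg ⟨hxU, hx⟩).symm).mono_of_mem_nhdsWithin
    (inter_mem (mem_nhdsWithin_of_mem_nhds (hU.mem_nhds hxU)) self_mem_nhdsWithin)

theorem IsCr.slice {V₁ V₂ : Type*} [NormedAddCommGroup V₁] [NormedSpace ℝ V₁]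
    [NormedAddCommGroup V₂] [NormedSpace ℝ V₂] {r : ℕ} {S : Set ℝ} {X : Set V₁} {F : ℝ → V₁ → V₂}
    (h : IsCr r (S ×ˢ X) (fun p : ℝ × V₁ => F p.1 p.2)) {t : ℝ} (ht : t ∈ S) :
    IsCr r X (F t) := by
  intro x hx
  obtain ⟨U, hU, hxU, G, hG, hGg⟩ := h (t, x) ⟨ht, hx⟩
  refine ⟨(fun y => (t, y)) ⁻¹' U, hU.preimage (by fun_prop), hxU, fun y => G (t, y), ?_, ?_⟩
  · exact hG.comp (contDiff_prodMk_right t).contDiffOn fun y hy => hy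
  · exact fun y hy => hGg ⟨hy.1, ht, hy.2⟩

variable {n d : ℕ} {f P : E n → ℝ} {γ C : ℝ}

theorem contDiffAt_gradient {m : ℕ} {x : E n} (hf : ContDiffAt ℝ (m + 1 : ℕ) f x) :
    ContDiffAt ℝ m (∇ f) x :=
  (InnerProductSpace.toDual ℝ (E n)).symm.contDiff.contDiffAt.comp x
    (hf.fderiv_right (m := m) (by push_cast; rfl))

/-- The assumptions on two functions on the unit ball under which the zero set of `f` is isotopic,
along its normals, to a part of the zero set of `P`. -/
structure NormallyClose (d : ℕ) (f P : E n → ℝ) (γ C : ℝ) : Prop where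
  d_pos : 1 ≤ d
  γ_pos : 0 < γ
  γ_lt : γ < 1
  one_le : 1 ≤ C
  smooth : ∀ x ∈ ball (0 : E n) 1, ContDiffAt ℝ (d + 1 : ℕ) f x
  smooth' : ContDiff ℝ (d + 1 : ℕ) P
  lip : ∀ x ∈ ball (0 : E n) 1, ∀ y ∈ ball (0 : E n) 1, ‖∇ f y - ∇ f x‖ ≤ C * ‖y - x‖
  -- The bound is the least growth of the homotopy along a normal of length `γ / (4 * C)`: slope `γ
  -- / 2` per unit length.
  close : ∀ x ∈ ball (0 : E n) 1, |P x - f x| < γ ^ 2 / (8 * C)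
  gradient_close : ∀ x ∈ ball (0 : E n) 1, ‖∇ P x - ∇ f x‖ ≤ γ / 4
  norm_le : ∀ x ∈ levelSet f 0, ‖x‖ ≤ 1 / 2
  regular : ∀ x ∈ levelSet f 0, γ ≤ ‖∇ f x‖

/-- The point at parameter `s` on the normal at `x` to the level set of `f` through `x`. -/
def normalPoint (f : E n → ℝ) (x : E n) (s : ℝ) : E n := x + s • ∇ f x

/-- The linear homotopy from `f` to `P`. -/
def linHomotopy (f P : E n → ℝ) (t : ℝ) (x : E n) : ℝ := f x + t * (P x - f x)

namespace NormallyClose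

variable (H : NormallyClose d f P γ C)
include H

theorem C_pos : 0 < C := zero_lt_one.trans_le H.one_le

theorem radius_lt : γ / (4 * C) < 1 / 4 := by
  have := H.one_le
  have := H.γ_lt
  rw [div_lt_div_iff₀ (by linarith) (by norm_num)]
  linarith

theorem C_mul_radius : C * (γ / (4 * C)) = γ / 4 := by
  have := H.C_pos
  field_simp

theorem mem_ball_of_mem {x : E n} (hx : x ∈ levelSet f 0) : x ∈ ball (0 : E n) 1 :=
  mem_ball_zero_iff.2 ((H.norm_le x hx).trans_lt (by norm_num))

theorem gradient_norm_pos {x : E n} (hx : x ∈ levelSet f 0) : 0 < ‖∇ f x‖ :=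
  H.γ_pos.trans_le (H.regular x hx)

theorem normalPoint_mem_ball {x : E n} (hx : x ∈ levelSet f 0) {s : ℝ}
    (hs : ‖s • ∇ f x‖ ≤ γ / (4 * C)) : normalPoint f x s ∈ ball (0 : E n) 1 := by
  rw [mem_ball_zero_iff]
  refine (norm_add_le _ _).trans_lt ?_
  linarith [H.norm_le x hx, H.radius_lt]

theorem hasGradientAt {x : E n} (hx : x ∈ ball (0 : E n) 1) : HasGradientAt f (∇ f x) x :=
  ((H.smooth x hx).differentiableAt (by simp)).hasGradientAt

theorem hasGradientAt' (x : E n) : HasGradientAt P (∇ P x) x :=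
  ((H.smooth'.differentiable (by simp)) x).hasGradientAt

theorem hasFDerivAt_linHomotopy {t : ℝ} {x : E n} (hx : x ∈ ball (0 : E n) 1) :
    HasFDerivAt (linHomotopy f P t)
      (InnerProductSpace.toDual ℝ (E n) (∇ f x + t • (∇ P x - ∇ f x))) x := by
  have h : HasFDerivAt (linHomotopy f P t) _ x := (H.hasGradientAt hx).hasFDerivAt.add
    (((H.hasGradientAt' x).hasFDerivAt.sub (H.hasGradientAt hx).hasFDerivAt).const_mul t)
  exact h.congr_fderiv (by simp)

/-- The derivative along the normal of the functions of the homotopy. -/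
theorem hasDerivAt_normal {t : ℝ} (ht : t ∈ Icc (0 : ℝ) 1) {x : E n} (hx : x ∈ levelSet f 0) {s : ℝ}
    (hs : ‖s • ∇ f x‖ ≤ γ / (4 * C)) :
    ∃ a, HasDerivAt (fun σ => linHomotopy f P t (normalPoint f x σ)) a s ∧
      γ / 2 * ‖∇ f x‖ ≤ a := by
  set N := ∇ f x with hN
  have hx' := H.mem_ball_of_mem hx
  have hy := H.normalPoint_mem_ball hx hs
  set y := normalPoint f x s with hy'
  have hl : HasDerivAt (normalPoint f x) N s := by
    have : HasDerivAt (normalPoint f x) _ s := ((hasDerivAt_id s).smul_const N).const_add x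
    exact this.congr_deriv (one_smul ℝ N)
  have hcomp := (H.hasFDerivAt_linHomotopy (t := t) hy).comp_hasDerivAt s hl
  refine ⟨_, hcomp, ?_⟩
  rw [InnerProductSpace.toDual_apply_apply]
  -- The main term is at least `γ * ‖N‖`; the turning of `∇ f` and the difference `∇ P - ∇ f` each
  -- cost at most a quarter of that.
  have hsplit : ⟪∇ f y + t • (∇ P y - ∇ f y), N⟫
      = ‖N‖ ^ 2 + ⟪∇ f y - N, N⟫ + t * ⟪∇ P y - ∇ f y, N⟫ := by
    rw [inner_add_left, inner_sub_left (∇ f y) N, inner_smul_left, real_inner_self_eq_norm_sq]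
    simp
  have hyx : y - x = s • N := by simp [hy', normalPoint, hN]
  have h1 : |⟪∇ f y - N, N⟫| ≤ γ / 4 * ‖N‖ := by
    refine (abs_real_inner_le_norm _ _).trans (mul_le_mul_of_nonneg_right ?_ (norm_nonneg _))
    refine (H.lip x hx' y hy).trans ?_
    rw [hyx, ← H.C_mul_radius]
    exact mul_le_mul_of_nonneg_left hs H.C_pos.le
  have h2 : |t * ⟪∇ P y - ∇ f y, N⟫| ≤ γ / 4 * ‖N‖ := by
    rw [abs_mul, abs_of_nonneg ht.1]
    refine (mul_le_of_le_one_left (abs_nonneg _) ht.2).trans ?_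
    exact (abs_real_inner_le_norm _ _).trans
      (mul_le_mul_of_nonneg_right (H.gradient_close y hy) (norm_nonneg _))
  have h3 : γ * ‖N‖ ≤ ‖N‖ ^ 2 := by
    rw [pow_two]
    exact mul_le_mul_of_nonneg_right (H.regular x hx) (norm_nonneg _)
  rw [hsplit]
  linarith [neg_abs_le ⟪∇ f y - N, N⟫, neg_abs_le (t * ⟪∇ P y - ∇ f y, N⟫)]

theorem norm_smul_le_iff {x : E n} (hx : x ∈ levelSet f 0) {s ρ : ℝ} :
    ‖s • ∇ f x‖ ≤ ρ ↔ s ∈ Icc (-(ρ / ‖∇ f x‖)) (ρ / ‖∇ f x‖) := by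
  rw [norm_smul, ← le_div_iff₀ (H.gradient_norm_pos hx), Real.norm_eq_abs, abs_le, mem_Icc]

theorem norm_smul_lt_iff {x : E n} (hx : x ∈ levelSet f 0) {s ρ : ℝ} :
    ‖s • ∇ f x‖ < ρ ↔ s ∈ Ioo (-(ρ / ‖∇ f x‖)) (ρ / ‖∇ f x‖) := by
  rw [norm_smul, ← lt_div_iff₀ (H.gradient_norm_pos hx), Real.norm_eq_abs, abs_lt, mem_Ioo]

theorem linHomotopy_normal_sub_le {t : ℝ} (ht : t ∈ Icc (0 : ℝ) 1) {x : E n}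
    (hx : x ∈ levelSet f 0) {s s' : ℝ} (hs : ‖s • ∇ f x‖ ≤ γ / (4 * C))
    (hs' : ‖s' • ∇ f x‖ ≤ γ / (4 * C)) (hss : s ≤ s') :
    γ / 2 * ‖∇ f x‖ * (s' - s)
      ≤ linHomotopy f P t (normalPoint f x s') - linHomotopy f P t (normalPoint f x s) := by
  have hd := fun σ (hσ : σ ∈ Icc (-(γ / (4 * C) / ‖∇ f x‖)) (γ / (4 * C) / ‖∇ f x‖)) =>
    H.hasDerivAt_normal ht hx ((H.norm_smul_le_iff hx).2 hσ)
  refine (convex_Icc (-(γ / (4 * C) / ‖∇ f x‖)) (γ / (4 * C) / ‖∇ f x‖)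
    ).mul_sub_le_image_sub_of_le_deriv
    (f := fun σ => linHomotopy f P t (normalPoint f x σ)) ?_ ?_ ?_ s
    ((H.norm_smul_le_iff hx).1 hs) s' ((H.norm_smul_le_iff hx).1 hs') hss
  · intro σ hσ
    obtain ⟨a, ha, _⟩ := hd σ hσ
    exact ha.continuousAt.continuousWithinAt
  · intro σ hσ
    obtain ⟨a, ha, _⟩ := hd σ (interior_subset hσ)
    exact ha.differentiableAt.differentiableWithinAt
  · intro σ hσ
    obtain ⟨a, ha, ha'⟩ := hd σ (interior_subset hσ)
    rwa [ha.deriv]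

theorem shift_unique {t : ℝ} (ht : t ∈ Icc (0 : ℝ) 1) {x : E n}
    (hx : x ∈ levelSet f 0) {s s' : ℝ} (hs : ‖s • ∇ f x‖ < γ / (4 * C))
    (hs' : ‖s' • ∇ f x‖ < γ / (4 * C)) (h : linHomotopy f P t (normalPoint f x s) = 0)
    (h' : linHomotopy f P t (normalPoint f x s') = 0) : s = s' := by
  have hpos : 0 < γ / 2 * ‖∇ f x‖ := mul_pos (half_pos H.γ_pos) (H.gradient_norm_pos hx)
  rcases lt_trichotomy s s' with hlt | heq | hlt
  · have := H.linHomotopy_normal_sub_le ht hx hs.le hs'.le hlt.le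
    rw [h, h', sub_zero] at this
    exact absurd this (not_le.2 (mul_pos hpos (sub_pos.2 hlt)))
  · exact heq
  · have := H.linHomotopy_normal_sub_le ht hx hs'.le hs.le hlt.le
    rw [h, h', sub_zero] at this
    exact absurd this (not_le.2 (mul_pos hpos (sub_pos.2 hlt)))

/-- At `s = 0` the homotopy is smaller in absolute value than `γ ^ 2 / (8 * C)`, and it changes by
at least this much towards either end of the normal, so it has opposite signs at the ends. -/
theorem exists_shift {t : ℝ} (ht : t ∈ Icc (0 : ℝ) 1) {x : E n} (hx : x ∈ levelSet f 0) :
    ∃ s : ℝ, ‖s • ∇ f x‖ < γ / (4 * C) ∧ linHomotopy f P t (normalPoint f x s) = 0 := by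
  have hN := H.gradient_norm_pos hx
  set ρ := γ / (4 * C) / ‖∇ f x‖ with hρ
  have hC := H.C_pos
  have hγ := H.γ_pos
  have hρ0 : 0 < ρ := by positivity
  have hmem : ∀ σ ∈ Icc (-ρ) ρ, ‖σ • ∇ f x‖ ≤ γ / (4 * C) := fun σ hσ =>
    (H.norm_smul_le_iff hx).2 hσ
  have h0 : |linHomotopy f P t (normalPoint f x 0)| < γ ^ 2 / (8 * C) := by
    have : linHomotopy f P t (normalPoint f x 0) = t * (P x - f x) := by
      simp [linHomotopy, normalPoint, hx.2]
    rw [this, abs_mul, abs_of_nonneg ht.1]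
    exact (mul_le_of_le_one_left (abs_nonneg _) ht.2).trans_lt
      (H.close x (H.mem_ball_of_mem hx))
  have hval : γ / 2 * ‖∇ f x‖ * ρ = γ ^ 2 / (8 * C) := by
    rw [hρ]; field_simp; norm_num
  have hup := H.linHomotopy_normal_sub_le ht hx (hmem 0 ⟨by linarith, hρ0.le⟩)
    (hmem ρ ⟨by linarith, le_rfl⟩) hρ0.le
  have hdown := H.linHomotopy_normal_sub_le ht hx (hmem (-ρ) ⟨le_rfl, by linarith⟩)
    (hmem 0 ⟨by linarith, hρ0.le⟩) (by linarith)
  rw [sub_zero, hval] at hup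
  rw [zero_sub, neg_neg, hval] at hdown
  rw [abs_lt] at h0
  have hcont : ContinuousOn (fun σ => linHomotopy f P t (normalPoint f x σ)) (Icc (-ρ) ρ) := by
    intro σ hσ
    obtain ⟨a, ha, _⟩ := H.hasDerivAt_normal ht hx (hmem σ hσ)
    exact ha.continuousAt.continuousWithinAt
  obtain ⟨s, hs, hs'⟩ := intermediate_value_Ioo (by linarith) hcont
    (show (0 : ℝ) ∈ Ioo _ _ from ⟨by linarith, by linarith⟩)
  exact ⟨s, (H.norm_smul_lt_iff hx).2 hs, hs'⟩

/-- The Taylor estimate that bounds the curvature of the zero set from above. -/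
theorem inner_gradient_le {x y : E n} (hx : x ∈ levelSet f 0) (hy : y ∈ levelSet f 0) :
    |⟪∇ f x, y - x⟫| ≤ C * ‖y - x‖ ^ 2 := by
  have hx' := H.mem_ball_of_mem hx
  have hy' := H.mem_ball_of_mem hy
  have hseg : segment ℝ x y ⊆ ball (0 : E n) 1 := (convex_ball _ _).segment_subset hx' hy'
  have hbound : ∀ z ∈ segment ℝ x y, ‖InnerProductSpace.toDual ℝ (E n) (∇ f z)
      - InnerProductSpace.toDual ℝ (E n) (∇ f x)‖ ≤ C * ‖y - x‖ := fun z hz => by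
    rw [← map_sub, LinearIsometryEquiv.norm_map]
    exact (H.lip x hx' z (hseg hz)).trans
      (mul_le_mul_of_nonneg_left (norm_sub_le_of_mem_segment hz) H.C_pos.le)
  have h := (convex_segment x y).norm_image_sub_le_of_norm_hasFDerivWithin_le' (f := f)
    (fun z hz => (H.hasGradientAt (hseg hz)).hasFDerivAt.hasFDerivWithinAt) hbound
    (left_mem_segment ℝ x y) (right_mem_segment ℝ x y)
  rw [hx.2, hy.2, InnerProductSpace.toDual_apply_apply, sub_zero, zero_sub, norm_neg,
    Real.norm_eq_abs, mul_assoc, ← pow_two] at h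
  exact h

/-- The point on the normal at `x` is strictly nearer to `x` than to any other zero `y`: in the
expansion of `‖s • ∇ f x - (y - x)‖ ^ 2` the cross term is at most `‖y - x‖ ^ 2 / 2`, by
`inner_gradient_le` and `|s| * C ≤ 1 / 4`. Exchanging `x` and `y` then gives a contradiction. -/
theorem norm_lt_of_normalPoint_eq {x y : E n} (hx : x ∈ levelSet f 0) (hy : y ∈ levelSet f 0)
    {s s' : ℝ} (hs : ‖s • ∇ f x‖ < γ / (4 * C))
    (h : normalPoint f x s = normalPoint f y s') (hxy : x ≠ y) :
    ‖s • ∇ f x‖ < ‖s' • ∇ f y‖ := by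
  have hv : 0 < ‖y - x‖ := norm_pos_iff.2 (sub_ne_zero.2 hxy.symm)
  have hC := H.C_pos
  have heq : s' • ∇ f y = s • ∇ f x - (y - x) := by
    simp only [normalPoint] at h
    rw [eq_sub_iff_add_eq, ← sub_eq_zero]
    rw [← sub_eq_zero] at h
    rw [← neg_eq_zero, ← h]
    abel
  have hsabs : |s| * C ≤ 1 / 4 := by
    have h1 : |s| * γ < γ / (4 * C) := by
      refine lt_of_le_of_lt ?_ hs
      rw [norm_smul, Real.norm_eq_abs]
      exact mul_le_mul_of_nonneg_left (H.regular x hx) (abs_nonneg _)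
    rw [lt_div_iff₀ (by positivity)] at h1
    have := H.γ_pos
    by_contra hcon
    nlinarith
  have hinner : |⟪s • ∇ f x, y - x⟫| ≤ 1 / 4 * ‖y - x‖ ^ 2 := by
    rw [inner_smul_left, abs_mul]
    calc _ ≤ |s| * (C * ‖y - x‖ ^ 2) := by
          simpa using mul_le_mul_of_nonneg_left (H.inner_gradient_le hx hy) (abs_nonneg s)
      _ = |s| * C * ‖y - x‖ ^ 2 := by ring
      _ ≤ _ := mul_le_mul_of_nonneg_right hsabs (by positivity)
  have hsq : ‖s • ∇ f x‖ ^ 2 < ‖s' • ∇ f y‖ ^ 2 := by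
    rw [heq, norm_sub_sq_real]
    nlinarith [le_abs_self ⟪s • ∇ f x, y - x⟫, pow_pos hv 2]
  exact lt_of_pow_lt_pow_left₀ 2 (norm_nonneg _) hsq

/-- The normals of length `γ / (4 * C)` at different points of the zero set do not meet. -/
theorem normalPoint_injective {x y : E n} (hx : x ∈ levelSet f 0) (hy : y ∈ levelSet f 0)
    {s s' : ℝ} (hs : ‖s • ∇ f x‖ < γ / (4 * C)) (hs' : ‖s' • ∇ f y‖ < γ / (4 * C))
    (h : normalPoint f x s = normalPoint f y s') : x = y := by
  by_contra hxy
  exact lt_asymm (H.norm_lt_of_normalPoint_eq hx hy hs h hxy)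
    (H.norm_lt_of_normalPoint_eq hy hx hs' h.symm (Ne.symm hxy))

end NormallyClose

end Isotopy

/-! ### Construction of the isotopy and identification of its final set. -/

section Isotopy

open Filter Topology
open scoped Gradient RealInnerProductSpace

variable {n d : ℕ} {f P : E n → ℝ} {γ C : ℝ}

/-- The normal coordinate at `x` of the zero set of the homotopy at time `t`. -/
def normalShift (f P : E n → ℝ) (ρ t : ℝ) (x : E n) : ℝ := by
  classical exact
  if h : ∃ s : ℝ, ‖s • ∇ f x‖ < ρ ∧ linHomotopy f P t (normalPoint f x s) = 0 then h.choose else 0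

/-- The isotopy along normals. -/
def normalIsotopy (f P : E n → ℝ) (ρ t : ℝ) (x : E n) : E n :=
  normalPoint f x (normalShift f P ρ t x)

/-- The foot of a normal of length less than `ρ` to the zero set of `f` that passes through `y`. -/
def normalFoot (f : E n → ℝ) (ρ : ℝ) (y : E n) : E n := by
  classical exact
  if h : ∃ x ∈ levelSet f 0, ∃ s : ℝ, ‖s • ∇ f x‖ < ρ ∧ y = normalPoint f x s then h.choose else 0

namespace NormallyClose

variable (H : NormallyClose d f P γ C)
include H

theorem normalShift_spec {t : ℝ} (ht : t ∈ Icc (0 : ℝ) 1) {x : E n} (hx : x ∈ levelSet f 0) :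
    ‖normalShift f P (γ / (4 * C)) t x • ∇ f x‖ < γ / (4 * C) ∧
      linHomotopy f P t (normalIsotopy f P (γ / (4 * C)) t x) = 0 := by
  have h := H.exists_shift ht hx
  rw [normalIsotopy, normalShift, dif_pos h]
  exact h.choose_spec

theorem normalShift_eq {t : ℝ} (ht : t ∈ Icc (0 : ℝ) 1) {x : E n} (hx : x ∈ levelSet f 0) {s : ℝ}
    (hs : ‖s • ∇ f x‖ < γ / (4 * C)) (h : linHomotopy f P t (normalPoint f x s) = 0) :
    normalShift f P (γ / (4 * C)) t x = s :=
  H.shift_unique ht hx (H.normalShift_spec ht hx).1 hs (H.normalShift_spec ht hx).2 h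

theorem normalFoot_normalPoint {x : E n} (hx : x ∈ levelSet f 0) {s : ℝ}
    (hs : ‖s • ∇ f x‖ < γ / (4 * C)) :
    normalFoot f (γ / (4 * C)) (normalPoint f x s) = x := by
  have h : ∃ x' ∈ levelSet f 0, ∃ s' : ℝ, ‖s' • ∇ f x'‖ < γ / (4 * C) ∧
    normalPoint f x s = normalPoint f x' s' := ⟨x, hx, s, hs, rfl⟩
  rw [normalFoot, dif_pos h]
  obtain ⟨hx', s', hs', heq⟩ := h.choose_spec
  exact H.normalPoint_injective hx' hx hs' hs heq.symm

theorem d_ne_zero : ((d : ℕ) : WithTop ℕ∞) ≠ 0 := by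
  exact_mod_cast (Nat.one_le_iff_ne_zero.1 H.d_pos)

theorem contDiffAt_normalPoint {x : E n} (hx : x ∈ ball (0 : E n) 1) (s : ℝ) :
    ContDiffAt ℝ d (fun q : E n × ℝ => normalPoint f q.1 q.2) (x, s) :=
  contDiffAt_fst.add (contDiffAt_snd.smul
    (ContDiffAt.comp (g := ∇ f) (x, s) (contDiffAt_gradient (H.smooth x hx)) contDiffAt_fst))

theorem norm_fderiv_gradient_le {x : E n} (hx : x ∈ ball (0 : E n) 1) :
    ‖fderiv ℝ (∇ f) x‖ ≤ C :=
  norm_fderiv_le_of_lip' ℝ H.C_pos.le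
    ((isOpen_ball.eventually_mem hx).mono fun y hy => H.lip x hx y hy)

theorem abs_mul_lt_one {x : E n} (hx : x ∈ levelSet f 0) {s : ℝ}
    (hs : ‖s • ∇ f x‖ < γ / (4 * C)) : |s| * C < 1 := by
  have hC := H.C_pos
  have h1 : |s| * γ < γ / (4 * C) := by
    refine lt_of_le_of_lt ?_ hs
    rw [norm_smul, Real.norm_eq_abs]
    exact mul_le_mul_of_nonneg_left (H.regular x hx) (abs_nonneg _)
  rw [lt_div_iff₀ (by positivity)] at h1
  have := H.γ_pos
  by_contra hcon
  nlinarith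

/-- The normal coordinates around the zero set of `f` have an invertible derivative. -/
theorem exists_equiv_hasFDerivAt_tube {x : E n} (hx : x ∈ levelSet f 0) {s : ℝ}
    (hs : ‖s • ∇ f x‖ < γ / (4 * C)) :
    ∃ L : (E n × ℝ) ≃L[ℝ] (E n × ℝ),
      HasFDerivAt (fun q : E n × ℝ => (normalPoint f q.1 q.2, f q.1))
        (L : (E n × ℝ) →L[ℝ] (E n × ℝ)) (x, s) := by
  have hx' := H.mem_ball_of_mem hx
  have hN : HasFDerivAt (∇ f) (fderiv ℝ (∇ f) x) x :=
    ((contDiffAt_gradient (H.smooth x hx')).differentiableAt H.d_ne_zero).hasFDerivAt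
  have hfst : HasFDerivAt (fun q : E n × ℝ => q.1) (ContinuousLinearMap.fst ℝ (E n) ℝ) (x, s) :=
    hasFDerivAt_fst
  have hsnd : HasFDerivAt (fun q : E n × ℝ => q.2) (ContinuousLinearMap.snd ℝ (E n) ℝ) (x, s) :=
    hasFDerivAt_snd
  have hN' : HasFDerivAt (fun q : E n × ℝ => ∇ f q.1)
      ((fderiv ℝ (∇ f) x).comp (ContinuousLinearMap.fst ℝ (E n) ℝ)) (x, s) :=
    HasFDerivAt.comp (g := ∇ f) (x, s) hN hfst
  have hf' : HasFDerivAt (fun q : E n × ℝ => f q.1)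
      ((InnerProductSpace.toDual ℝ (E n) (∇ f x)).comp (ContinuousLinearMap.fst ℝ (E n) ℝ))
      (x, s) :=
    HasFDerivAt.comp (x, s) (H.hasGradientAt hx').hasFDerivAt hfst
  have hΨ := (hfst.add (hsnd.smul hN')).prodMk hf'
  set A := ((ContinuousLinearMap.fst ℝ (E n) ℝ + (s • ((fderiv ℝ (∇ f) x).comp
    (ContinuousLinearMap.fst ℝ (E n) ℝ)) + (ContinuousLinearMap.snd ℝ (E n) ℝ).smulRight
      (∇ f x))).prod ((InnerProductSpace.toDual ℝ (E n) (∇ f x)).comp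
        (ContinuousLinearMap.fst ℝ (E n) ℝ))) with hA
  -- For `(v, σ)` in the kernel, `v` is orthogonal to `∇ f x`. Pairing the first component with `v`
  -- gives `‖v‖ ^ 2 + s * ⟪D(∇ f) v, v⟫ = 0`, so `v = 0` because `|s| * C < 1`.
  have hinj : Function.Injective (A : (E n × ℝ) →ₗ[ℝ] (E n × ℝ)) := by
    rw [← LinearMap.ker_eq_bot, LinearMap.ker_eq_bot']
    rintro ⟨v, σ⟩ hv
    have h1 : v + (s • fderiv ℝ (∇ f) x v + σ • ∇ f x) = 0 := congrArg Prod.fst hv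
    have h2 : ⟪∇ f x, v⟫ = 0 := congrArg Prod.snd hv
    have h3 : ‖v‖ ^ 2 + s * ⟪fderiv ℝ (∇ f) x v, v⟫ = 0 := by
      have h4 := congrArg (fun w => ⟪w, v⟫) h1
      simp only [inner_add_left, inner_smul_left, h2, inner_zero_left] at h4
      rw [← real_inner_self_eq_norm_sq]
      simpa using h4
    have h5 : |s * ⟪fderiv ℝ (∇ f) x v, v⟫| ≤ |s| * C * ‖v‖ ^ 2 := by
      rw [abs_mul, mul_assoc, pow_two, ← mul_assoc C]
      refine mul_le_mul_of_nonneg_left ((abs_real_inner_le_norm _ _).trans ?_) (abs_nonneg s)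
      refine mul_le_mul_of_nonneg_right ?_ (norm_nonneg v)
      exact ((fderiv ℝ (∇ f) x).le_opNorm v).trans
        (mul_le_mul_of_nonneg_right (H.norm_fderiv_gradient_le hx') (norm_nonneg v))
    have hv0 : v = 0 := by
      by_contra hne
      have hpos : 0 < ‖v‖ ^ 2 := pow_pos (norm_pos_iff.2 hne) 2
      nlinarith [H.abs_mul_lt_one hx hs, neg_abs_le (s * ⟪fderiv ℝ (∇ f) x v, v⟫)]
    rw [hv0, map_zero, smul_zero, zero_add, zero_add] at h1
    have hσ : σ = 0 := (smul_eq_zero.1 h1).resolve_right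
      (norm_pos_iff.1 (H.gradient_norm_pos hx))
    rw [hv0, hσ]; rfl
  refine ⟨(LinearEquiv.ofInjectiveEndo _ hinj).toContinuousLinearEquiv, ?_⟩
  have hcoe : ((LinearEquiv.ofInjectiveEndo _ hinj).toContinuousLinearEquiv :
      (E n × ℝ) →L[ℝ] (E n × ℝ)) = A := by
    exact ContinuousLinearMap.ext fun q => rfl
  rw [hcoe]
  exact hΨ

/-- The foot of the normal is, locally, a map of class `C^d`. -/
theorem exists_local_foot {x : E n} (hx : x ∈ levelSet f 0) {s : ℝ}
    (hs : ‖s • ∇ f x‖ < γ / (4 * C)) :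
    ∃ h : E n → E n, ContDiffAt ℝ d h (normalPoint f x s) ∧ ∀ᶠ y in 𝓝 (normalPoint f x s),
      h y ∈ levelSet f 0 ∧ ∃ σ : ℝ, ‖σ • ∇ f (h y)‖ < γ / (4 * C) ∧ y = normalPoint f (h y) σ := by
  have hx' := H.mem_ball_of_mem hx
  obtain ⟨L, hL⟩ := H.exists_equiv_hasFDerivAt_tube hx hs
  have hcd : ContDiffAt ℝ d (fun q : E n × ℝ => (normalPoint f q.1 q.2, f q.1)) (x, s) :=
    (H.contDiffAt_normalPoint hx' s).prodMk
      (((H.smooth x hx').of_le (by exact_mod_cast Nat.le_succ d)).comp (x, s) contDiffAt_fst)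
  -- The second component of the map is `f`, so the inverse on the slice `(y, 0)` lands in the zero
  -- set: it returns the foot of `y`.
  let g := hcd.localInverse hL H.d_ne_zero
  have hbase : (normalPoint f x s, f x) = (normalPoint f x s, (0 : ℝ)) := by rw [hx.2]
  have hg0 : g (normalPoint f x s, 0) = (x, s) := by
    rw [← hbase]; exact hcd.localInverse_apply_image hL H.d_ne_zero
  have hg : ContDiffAt ℝ d g (normalPoint f x s, 0) := by
    rw [← hbase]; exact hcd.to_localInverse hL H.d_ne_zero
  have hin : ContDiffAt ℝ d (fun y : E n => (y, (0 : ℝ))) (normalPoint f x s) :=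
    contDiffAt_id.prodMk contDiffAt_const
  have hgy : ContDiffAt ℝ d (fun y => g (y, 0)) (normalPoint f x s) :=
    ContDiffAt.comp (normalPoint f x s) hg hin
  refine ⟨fun y => (g (y, 0)).1, contDiffAt_fst.comp _ hgy, ?_⟩
  have hright : ∀ᶠ p in 𝓝 (normalPoint f x s, (0 : ℝ)),
      (normalPoint f (g p).1 (g p).2, f (g p).1) = p := by
    rw [← hbase]
    exact (hcd.hasStrictFDerivAt' hL H.d_ne_zero).eventually_right_inverse
  have hcontg : ContinuousAt (fun y => g (y, 0)) (normalPoint f x s) := hgy.continuousAt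
  have hball : ∀ᶠ y in 𝓝 (normalPoint f x s), (g (y, 0)).1 ∈ ball (0 : E n) 1 := by
    refine (continuousAt_fst.comp hcontg).eventually_mem (isOpen_ball.mem_nhds ?_)
    simpa [hg0] using hx'
  have hlt : ∀ᶠ y in 𝓝 (normalPoint f x s),
      ‖(g (y, 0)).2 • ∇ f (g (y, 0)).1‖ < γ / (4 * C) := by
    have hc : ContinuousAt (fun q : E n × ℝ => ‖q.2 • ∇ f q.1‖) (g (normalPoint f x s, 0)) := by
      rw [hg0]
      exact (continuousAt_snd.smul (ContinuousAt.comp (g := ∇ f) (x := (x, s))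
        (contDiffAt_gradient (H.smooth x hx')).continuousAt continuousAt_fst)).norm
    have hc' : ContinuousAt (fun y => ‖(g (y, 0)).2 • ∇ f (g (y, 0)).1‖) (normalPoint f x s) :=
      ContinuousAt.comp (g := fun q : E n × ℝ => ‖q.2 • ∇ f q.1‖) hc hcontg
    refine hc'.eventually_lt continuousAt_const ?_
    simpa [hg0] using hs
  filter_upwards [hin.continuousAt.eventually hright, hball, hlt] with y h1 h2 h3
  exact ⟨⟨ball_subset_closedBall h2, congrArg Prod.snd h1⟩, _, h3, (congrArg Prod.fst h1).symm⟩

theorem contDiffAt_linHomotopy_normalPoint {x : E n} (hx : x ∈ levelSet f 0) {s : ℝ} (t : ℝ)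
    (hs : ‖s • ∇ f x‖ < γ / (4 * C)) :
    ContDiffAt ℝ d (fun q : (ℝ × E n) × ℝ => linHomotopy f P q.1.1 (normalPoint f q.1.2 q.2))
      ((t, x), s) := by
  have hy := H.normalPoint_mem_ball hx hs.le
  have hle : ((d : ℕ) : WithTop ℕ∞) ≤ ((d + 1 : ℕ) : WithTop ℕ∞) := by
    exact_mod_cast Nat.le_succ d
  have hin : ContDiffAt ℝ d (fun q : (ℝ × E n) × ℝ => (q.1.2, q.2)) ((t, x), s) := by fun_prop
  have hnp : ContDiffAt ℝ d (fun q : (ℝ × E n) × ℝ => normalPoint f q.1.2 q.2) ((t, x), s) :=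
    ContDiffAt.comp (g := fun q : E n × ℝ => normalPoint f q.1 q.2) ((t, x), s)
      (H.contDiffAt_normalPoint (H.mem_ball_of_mem hx) s) hin
  have hf' : ContDiffAt ℝ d (fun q : (ℝ × E n) × ℝ => f (normalPoint f q.1.2 q.2)) ((t, x), s) :=
    ContDiffAt.comp (g := f) ((t, x), s) ((H.smooth _ hy).of_le hle) hnp
  have hP' : ContDiffAt ℝ d (fun q : (ℝ × E n) × ℝ => P (normalPoint f q.1.2 q.2)) ((t, x), s) :=
    ContDiffAt.comp (g := P) ((t, x), s) (H.smooth'.contDiffAt.of_le hle) hnp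
  have ht : ContDiffAt ℝ d (fun q : (ℝ × E n) × ℝ => q.1.1) ((t, x), s) := by fun_prop
  exact hf'.add (ht.mul (hP'.sub hf'))

/-- The implicit function theorem solves for `s` near `(t, x)` in the whole of `ℝ × E n`; on `[0, 1]
× Y_0(f)` uniqueness of the zero identifies the solution with `normalShift`. -/
theorem isCr_normalIsotopy : IsCr d (Icc (0 : ℝ) 1 ×ˢ levelSet f 0)
    (fun p : ℝ × E n => normalIsotopy f P (γ / (4 * C)) p.1 p.2) := by
  refine isCr_of_contDiffAt ?_
  rintro ⟨t, x⟩ ⟨ht, hx⟩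
  simp only at ht hx
  set s := normalShift f P (γ / (4 * C)) t x with hs_def
  obtain ⟨hs, h0⟩ := H.normalShift_spec ht hx
  have hx' := H.mem_ball_of_mem hx
  have cdf := H.contDiffAt_linHomotopy_normalPoint hx t hs
  rw [← hs_def] at hs cdf
  have hinv : (fderiv ℝ (fun q : (ℝ × E n) × ℝ =>
      linHomotopy f P q.1.1 (normalPoint f q.1.2 q.2)) ((t, x), s) ∘L
        .inr ℝ (ℝ × E n) ℝ).IsInvertible := by
    obtain ⟨a, ha, ha'⟩ := H.hasDerivAt_normal ht hx hs.le
    have ha0 : a ≠ 0 := by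
      have := H.gradient_norm_pos hx
      have := H.γ_pos
      exact (lt_of_lt_of_le (by positivity) ha').ne'
    have h1 := HasFDerivAt.comp_hasDerivAt s
      (cdf.differentiableAt H.d_ne_zero).hasFDerivAt
      ((hasDerivAt_const s (t, x)).prodMk (hasDerivAt_id s))
    have h2 := h1.unique ha
    set D := fderiv ℝ (fun q : (ℝ × E n) × ℝ =>
      linHomotopy f P q.1.1 (normalPoint f q.1.2 q.2)) ((t, x), s) with hD
    have hD1 : ∀ c : ℝ, (D ∘L .inr ℝ (ℝ × E n) ℝ) c = c * a := by
      intro c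
      have : (D ∘L .inr ℝ (ℝ × E n) ℝ) 1 = a := h2
      rw [← this, ← smul_eq_mul, ← map_smul, smul_eq_mul, mul_one]
    refine ContinuousLinearMap.IsInvertible.of_inverse
      (g := a⁻¹ • ContinuousLinearMap.id ℝ ℝ) ?_ ?_
    · ext
      rw [ContinuousLinearMap.comp_apply, hD1]
      simp [ha0]
    · ext
      rw [ContinuousLinearMap.comp_apply, hD1]
      simp [ha0]
  let ψ := cdf.implicitFunction H.d_ne_zero hinv
  have hψ : ContDiffAt ℝ d ψ (t, x) := cdf.contDiffAt_implicitFunction H.d_ne_zero hinv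
  have hψ0 : ψ (t, x) = s := cdf.implicitFunction_apply_self H.d_ne_zero hinv
  have hpair : ContDiffAt ℝ d (fun p : ℝ × E n => (p.2, ψ p)) (t, x) :=
    contDiffAt_snd.prodMk hψ
  refine ⟨fun p => normalPoint f p.2 (ψ p), ?_, ?_⟩
  · refine ContDiffAt.comp (g := fun q : E n × ℝ => normalPoint f q.1 q.2) (t, x) ?_ hpair
    exact H.contDiffAt_normalPoint hx' _
  · have hlt : ∀ᶠ p : ℝ × E n in 𝓝 (t, x), ‖ψ p • ∇ f p.2‖ < γ / (4 * C) := by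
      have hc : ContinuousAt (fun p : ℝ × E n => ‖ψ p • ∇ f p.2‖) (t, x) :=
        (hψ.continuousAt.smul (ContinuousAt.comp (g := ∇ f)
          (contDiffAt_gradient (H.smooth x hx')).continuousAt continuousAt_snd)).norm
      refine hc.eventually_lt continuousAt_const ?_
      simpa [hψ0] using hs
    filter_upwards [hlt, cdf.eventually_apply_implicitFunction H.d_ne_zero hinv]
      with p h1 h2 hp
    have h3 : linHomotopy f P p.1 (normalPoint f p.2 (ψ p)) = 0 := h2.trans h0
    simp only [normalIsotopy]
    rw [H.normalShift_eq hp.1 hp.2 h1 h3]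

/-- The inverse `normalFoot` is the same for all `t`, and locally it agrees with the smooth foot
map. -/
theorem isCrEmbedding_normalIsotopy {t : ℝ} (ht : t ∈ Icc (0 : ℝ) 1) :
    IsCrEmbedding d (levelSet f 0) (normalIsotopy f P (γ / (4 * C)) t) := by
  refine ⟨H.isCr_normalIsotopy.slice ht, normalFoot f (γ / (4 * C)), ?_, fun x hx =>
    H.normalFoot_normalPoint hx (H.normalShift_spec ht hx).1⟩
  refine isCr_of_contDiffAt ?_
  rintro _ ⟨x, hx, rfl⟩
  obtain ⟨h, hh, hev⟩ := H.exists_local_foot hx (H.normalShift_spec ht hx).1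
  refine ⟨h, hh, hev.mono fun y hy _ => ?_⟩
  obtain ⟨hmem, σ, hσ, heq⟩ := hy
  conv_rhs => rw [heq]
  exact (H.normalFoot_normalPoint hmem hσ).symm

theorem normalIsotopy_zero {x : E n} (hx : x ∈ levelSet f 0) :
    normalIsotopy f P (γ / (4 * C)) 0 x = x := by
  have hγ := H.γ_pos
  have hC := H.C_pos
  rw [normalIsotopy, H.normalShift_eq (s := 0) (by simp) hx (by simp; positivity)
    (by simp [linHomotopy, normalPoint, hx.2])]
  simp [normalPoint]

theorem areIsotopic_image :
    AreIsotopic d (levelSet f 0) (normalIsotopy f P (γ / (4 * C)) 1 '' levelSet f 0) :=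
  ⟨normalIsotopy f P (γ / (4 * C)), H.isCr_normalIsotopy,
    fun _ ht => ⟨H.isCrEmbedding_normalIsotopy ht, fun _ hx => ball_subset_closedBall
      (H.normalPoint_mem_ball hx (H.normalShift_spec ht hx).1.le)⟩,
    fun _ hx => H.normalIsotopy_zero hx, rfl⟩

theorem eq_zero_of_mem_image {y : E n}
    (hy : y ∈ normalIsotopy f P (γ / (4 * C)) 1 '' levelSet f 0) : P y = 0 := by
  obtain ⟨x, hx, rfl⟩ := hy
  simpa [linHomotopy] using (H.normalShift_spec (t := 1) (by simp) hx).2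

/-- From `x` to `y` the gradient of `f` changes by at most `γ / 4`, and `∇ P` differs from it by at
most `γ / 4`, which leaves at least `γ / 2`. -/
theorem gradient_ne_zero_of_mem_image {y : E n}
    (hy : y ∈ normalIsotopy f P (γ / (4 * C)) 1 '' levelSet f 0) : ∇ P y ≠ 0 := by
  obtain ⟨x, hx, rfl⟩ := hy
  have hs := (H.normalShift_spec (t := 1) (by simp) hx).1
  set s := normalShift f P (γ / (4 * C)) 1 x with hsdef
  have hyb := H.normalPoint_mem_ball hx hs.le
  intro h0
  change ∇ P (normalPoint f x s) = 0 at h0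
  have h1 := H.gradient_close _ hyb
  rw [h0, zero_sub, norm_neg] at h1
  have h2 := H.lip x (H.mem_ball_of_mem hx) _ hyb
  have h3 : ‖normalPoint f x s - x‖ ≤ γ / (4 * C) := by
    rw [normalPoint, add_sub_cancel_left]; exact hs.le
  have h4 := (h2.trans (mul_le_mul_of_nonneg_left h3 H.C_pos.le)).trans_eq H.C_mul_radius
  have h5 := norm_sub_norm_le (∇ f x) (∇ f (normalPoint f x s))
  rw [norm_sub_rev] at h5
  linarith [H.regular x hx, H.γ_pos]

/-- Each point near the image lies on a short normal; if it is a zero of `P`, uniqueness of the zero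
on that normal puts it in the image. -/
theorem exists_isOpen_inter_eq : ∃ U : Set (E n), IsOpen U ∧
    U ∩ {y | P y = 0} = normalIsotopy f P (γ / (4 * C)) 1 '' levelSet f 0 := by
  have h1 : (1 : ℝ) ∈ Icc (0 : ℝ) 1 := by simp
  have key : ∀ x ∈ levelSet f 0, ∃ U : Set (E n), IsOpen U ∧
      normalIsotopy f P (γ / (4 * C)) 1 x ∈ U ∧
      ∀ y ∈ U, P y = 0 → y ∈ normalIsotopy f P (γ / (4 * C)) 1 '' levelSet f 0 := by
    intro x hx
    obtain ⟨h, -, hev⟩ := H.exists_local_foot hx (H.normalShift_spec h1 hx).1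
    obtain ⟨U, hU, hUo, hxU⟩ := _root_.eventually_nhds_iff.1 hev
    refine ⟨U, hUo, hxU, fun y hy hPy => ?_⟩
    obtain ⟨hmem, σ, hσ, heq⟩ := hU y hy
    refine ⟨h y, hmem, ?_⟩
    rw [normalIsotopy, H.normalShift_eq h1 hmem hσ (by rw [← heq]; simp [linHomotopy, hPy]), ← heq]
  choose! U hUo hxU hU using key
  refine ⟨⋃ x ∈ levelSet f 0, U x, isOpen_biUnion hUo, ?_⟩
  apply Subset.antisymm
  · rintro y ⟨hy, hPy⟩
    obtain ⟨x, hx, hyx⟩ := mem_iUnion₂.1 hy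
    exact hU x hx y hyx hPy
  · intro y hy
    refine ⟨?_, H.eq_zero_of_mem_image hy⟩
    obtain ⟨x, hx, rfl⟩ := hy
    exact mem_biUnion hx (hxU x hx)

end NormallyClose

theorem isCompact_levelSet (hf : ContinuousOn f (B n)) : IsCompact (levelSet f 0) := by
  have : levelSet f 0 = B n ∩ f ⁻¹' {0} := rfl
  rw [this]
  exact (isCompact_closedBall _ _).of_isClosed_subset
    (hf.preimage_isClosed_of_isClosed isClosed_closedBall isClosed_singleton) inter_subset_left

/-- `W` is relatively open and closed in `Z`, so a component of `Z` that meets `W` stays inside it.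
-/
theorem eq_iUnion_connectedComponentIn {X : Type*} [TopologicalSpace X] {Z W U : Set X}
    (hW : IsClosed W) (hU : IsOpen U) (h : U ∩ Z = W) :
    W = ⋃ x ∈ W, connectedComponentIn Z x := by
  have hWZ : W ⊆ Z := h ▸ inter_subset_right
  apply Subset.antisymm
  · exact fun x hx => mem_biUnion hx (mem_connectedComponentIn (hWZ hx))
  · refine iUnion₂_subset fun x hx => ?_
    have hpre : IsPreconnected (connectedComponentIn Z x) := isPreconnected_connectedComponentIn
    have hsub := connectedComponentIn_subset Z x
    rcases isPreconnected_iff_subset_of_disjoint.1 hpre U Wᶜ hU hW.isOpen_compl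
      (fun y hy => by
        by_cases hyW : y ∈ W
        · left; rw [← h] at hyW; exact hyW.1
        · exact Or.inr hyW)
      (by
        refine eq_empty_of_forall_notMem fun y hy => hy.2.2 ?_
        rw [← h]
        exact ⟨hy.2.1, hsub hy.1⟩) with hc | hc
    · rw [← h] at *
      exact fun y hy => ⟨hc hy, hsub hy⟩
    · exact absurd hx (hc (mem_connectedComponentIn (hWZ hx)))

theorem NormallyClose.exists_isotopic_union {Q : MvPolynomial (Fin n) ℝ}
    (H : NormallyClose d f (polyFun Q) γ C) (hf : ContinuousOn f (B n)) :
    ∃ W : Set (E n), IsUnionOfSmoothComponents Q W ∧ AreIsotopic d (levelSet f 0) W := by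
  refine ⟨_, ⟨⟨_, fun y hy => H.eq_zero_of_mem_image hy, ?_⟩,
    fun y hy => H.gradient_ne_zero_of_mem_image hy⟩, H.areIsotopic_image⟩
  obtain ⟨U, hU, hUW⟩ := H.exists_isOpen_inter_eq
  refine eq_iUnion_connectedComponentIn ?_ hU hUW
  exact ((isCompact_levelSet hf).image_of_continuousOn
    (H.isCr_normalIsotopy.slice (by simp : (1 : ℝ) ∈ Icc (0 : ℝ) 1)).continuousOn).isClosed

end Isotopy

/-! ### The threshold `T` yields the hypotheses of `NormallyClose`. -/

section Main

open Filter Topology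
open scoped Gradient

variable {n d : ℕ} {f : E n → ℝ}

theorem norm_gradient_sub (g h : E n → ℝ) (x y : E n) :
    ‖∇ g x - ∇ h y‖ = ‖fderiv ℝ g x - fderiv ℝ h y‖ := by
  rw [gradient, gradient, ← map_sub, LinearIsometryEquiv.norm_map]

theorem abs_sub_taylorPoly_le (hf : ContDiffOn ℝ (d + 1 : ℕ) f (B n)) {x : E n}
    (hx : x ∈ B n) : |f x - taylorPoly f d x| ≤ M (d + 1) f / (d + 1)! := by
  have hcont : ContinuousOn (fun x => |f x - taylorPoly f d x|) (closure (ball (0 : E n) 1)) := by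
    rw [closure_ball _ one_ne_zero]
    exact (hf.continuousOn.sub (contDiff_taylorPoly f d (m := 0)).continuous.continuousOn).abs
  rw [B, ← closure_ball _ one_ne_zero] at hx
  refine le_on_closure (fun y hy => ?_) hcont continuousOn_const hx
  have h := norm_iteratedFDeriv_sub_taylorPoly_le
    (fun z hz => hf.contDiffAt (closedBall_mem_nhds_of_mem hz)) (M_nonneg (d + 1) f)
    (fun z hz => norm_iteratedFDeriv_le_M hf hz) 0 (Nat.zero_le _) hy
  simpa using h

theorem M_zero_taylorPoly_le (hf : ContDiffOn ℝ (d + 1 : ℕ) f (B n)) :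
    M 0 (taylorPoly f d) ≤ M 0 f + M (d + 1) f / (d + 1)! := by
  refine M_le fun x hx => ?_
  have h0 : |f x| ≤ M 0 f := by
    rw [← derivNorm_zero]
    exact derivNorm_le_M (hf.of_le (by exact_mod_cast Nat.zero_le _)) hx
  rw [derivNorm_zero]
  have h1 := abs_sub_taylorPoly_le hf hx
  rw [abs_sub_comm] at h1
  have h2 := abs_add_le (f x) (taylorPoly f d x - f x)
  rw [add_sub_cancel] at h2
  linarith

/-- The second derivative of a function is controlled by `C₃` when the function is bounded by `1`
and close to its Taylor polynomial. -/
theorem norm_iteratedFDeriv_two_le (hd : 1 ≤ d) (hn : n ≠ 0)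
    (hf : ContDiffOn ℝ (d + 1 : ℕ) f (B n)) (hM₀ : M 0 f = 1) (hK : M (d + 1) f ≤ 1) {x : E n}
    (hx : x ∈ ball (0 : E n) 1) : ‖iteratedFDeriv ℝ 2 f x‖ ≤ C₃ n d := by
  have hCbar : 0 ≤ Cbar n d := zero_le_one.trans (one_le_Cbar hn hd)
  have hsm : ∀ z ∈ ball (0 : E n) 1, ContDiffAt ℝ (d + 1 : ℕ) f z := fun z hz =>
    hf.contDiffAt (closedBall_mem_nhds_of_mem hz)
  have h1 := norm_iteratedFDeriv_sub_taylorPoly_le hsm (M_nonneg (d + 1) f)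
    (fun z hz => norm_iteratedFDeriv_le_M hf hz) 2 (by omega) hx
  rw [iteratedFDeriv_sub_apply ((hsm x hx).of_le (by exact_mod_cast (by omega : 2 ≤ d + 1)))
    (contDiff_taylorPoly f d).contDiffAt, show d + 1 - 2 = d - 1 by omega] at h1
  have h2 : ‖iteratedFDeriv ℝ 2 (taylorPoly f d) x‖
      ≤ Cbar n d * (1 + M (d + 1) f / (d + 1)!) := by
    -- For `d = 1` the order `2` is outside the range of `Cbar`, but the Taylor polynomial is then
    -- affine.
    rcases hd.eq_or_lt with rfl | hd2
    · rw [iteratedFDeriv_succ_taylorPoly f 1 x, norm_zero]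
      have := M_nonneg (1 + 1) f
      positivity
    · obtain ⟨Q, hQ, hQf⟩ := exists_polyFun_eq_taylorPoly f d
      refine (norm_iteratedFDeriv_le_M (contDiff_taylorPoly f d).contDiffOn hx).trans ?_
      have h3 := M_polyFun_le hQ one_le_two hd2
      rw [hQf] at h3
      refine h3.trans (mul_le_mul_of_nonneg_left ?_ hCbar)
      exact (M_zero_taylorPoly_le hf).trans_eq (by rw [hM₀])
  have h4 : M (d + 1) f / (d + 1)! ≤ 1 / (d + 1)! := by gcongr
  have h5 : M (d + 1) f / (d - 1)! ≤ 1 / (d - 1)! := by gcongr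
  have h6 := norm_le_norm_sub_add (iteratedFDeriv ℝ 2 f x) (iteratedFDeriv ℝ 2 (taylorPoly f d) x)
  have h7 := mul_le_mul_of_nonneg_left (add_le_add_right h4 1) hCbar
  have h8 : Cbar n d * (1 + 1 / (d + 1)!) = Cbar n d + Cbar n d / (d + 1)! := by ring
  unfold C₃
  linarith

theorem one_le_C₃ (hd : 1 ≤ d) (hn : n ≠ 0) : 1 ≤ C₃ n d := by
  have h := one_le_Cbar hn hd
  have : 0 ≤ Cbar n d / ((d + 1)! : ℝ) + 1 / ((d - 1)! : ℝ) := by positivity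
  unfold C₃
  linarith

/-- Origin of `T`: the bound `1` serves the estimate of the second derivative, and `d ! * γ ^ 2 / (4
* C₃)` serves the closeness of values and gradients. -/
theorem normallyClose_taylorPoly (hd : 1 ≤ d) (hn : n ≠ 0)
    (hf : ContDiffOn ℝ (d + 1 : ℕ) f (B n)) (hM₀ : M 0 f = 1)
    (hhalf : ∀ x ∈ B n, f x = 0 → ‖x‖ ≤ 1 / 2) {γ : ℝ} (hγ₀ : 0 < γ) (hγ₁ : γ < 1)
    (hreg : IsRegularValue γ f 0) (hT : M (d + 1) f < T n d γ) :
    NormallyClose d f (taylorPoly f d) γ (C₃ n d) := by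
  have hC := one_le_C₃ hd hn
  have hC0 : 0 < C₃ n d := zero_lt_one.trans_le hC
  obtain ⟨hK1, hK2⟩ := lt_min_iff.1 hT
  have hsm : ∀ z ∈ ball (0 : E n) 1, ContDiffAt ℝ (d + 1 : ℕ) f z := fun z hz =>
    hf.contDiffAt (closedBall_mem_nhds_of_mem hz)
  have hfac : (0 : ℝ) < d ! := by positivity
  have hδ₁ : M (d + 1) f / d ! < γ ^ 2 / (4 * C₃ n d) := by
    rw [div_lt_iff₀ hfac]
    calc _ < _ := hK2
      _ = _ := by ring
  refine ⟨hd, hγ₀, hγ₁, hC, hsm, contDiff_taylorPoly f d, ?_, ?_, ?_, ?_, ?_⟩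
  · intro x hx y hy
    rw [norm_gradient_sub]
    refine (convex_ball _ _).norm_image_sub_le_of_norm_fderiv_le (𝕜 := ℝ) (fun z hz => ?_)
      (fun z hz => ?_) hx hy
    · exact ((hsm z hz).fderiv_right (m := d) (by push_cast; rfl)).differentiableAt
        (by exact_mod_cast Nat.one_le_iff_ne_zero.1 hd)
    · rw [← norm_iteratedFDeriv_one, norm_iteratedFDeriv_fderiv]
      exact norm_iteratedFDeriv_two_le hd hn hf hM₀ hK1.le hz
  · intro x hx
    rw [abs_sub_comm]
    refine (abs_sub_taylorPoly_le hf (ball_subset_closedBall hx)).trans_lt ?_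
    -- Since `d ≥ 1`, `(d + 1)! ≥ 2 * d !`; this turns `4 * C₃` into the required `8 * C₃`.
    have h2 : M (d + 1) f / (d + 1)! ≤ M (d + 1) f / d ! / 2 := by
      rw [div_div]
      refine div_le_div_of_nonneg_left (M_nonneg _ _) (by positivity) ?_
      rw [Nat.factorial_succ]
      push_cast
      have : (1 : ℝ) ≤ d := by exact_mod_cast hd
      nlinarith
    refine h2.trans_lt ?_
    calc _ < γ ^ 2 / (4 * C₃ n d) / 2 := by linarith
      _ = _ := by rw [div_div]; ring_nf
  · intro x hx
    rw [norm_sub_rev, norm_gradient_sub]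
    have h := norm_iteratedFDeriv_sub_taylorPoly_le hsm (M_nonneg (d + 1) f)
      (fun z hz => norm_iteratedFDeriv_le_M hf hz) 1 (by omega) hx
    rw [norm_iteratedFDeriv_one, fderiv_sub ((hsm x hx).differentiableAt (by simp))
      ((contDiff_taylorPoly f d (m := 1)).differentiable one_ne_zero x),
      Nat.add_sub_cancel] at h
    refine (h.trans hδ₁.le).trans ?_
    -- Here `γ ^ 2 / (4 * C₃) ≤ γ / 4` because `γ < 1 ≤ C₃`.
    rw [div_le_div_iff₀ (by positivity) (by norm_num)]
    nlinarith
  · exact fun x hx => hhalf x hx.1 hx.2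
  · intro x hx
    have h := hreg x hx.1 hx.2
    have hxb : B n ∈ 𝓝 x := closedBall_mem_nhds_of_mem
      (mem_ball_zero_iff.2 ((hhalf x hx.1 hx.2).trans_lt (by norm_num)))
    rwa [gradientWithin, fderivWithin_of_mem_nhds hxb] at h

theorem areIsotopic_empty (r : ℕ) : AreIsotopic r (∅ : Set (E n)) ∅ :=
  ⟨fun _ x => x, fun p hp => absurd hp.2 (notMem_empty _),
    fun _ _ => ⟨⟨fun _ hx => absurd hx (notMem_empty _), id,
      fun _ hx => absurd hx (by simp), fun _ hx => absurd hx (notMem_empty _)⟩,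
      fun _ hx => absurd hx (notMem_empty _)⟩,
    fun _ hx => absurd hx (notMem_empty _), image_empty _⟩

theorem isUnionOfSmoothComponents_empty (P : MvPolynomial (Fin n) ℝ) :
    IsUnionOfSmoothComponents P ∅ :=
  ⟨⟨∅, empty_subset _, by simp⟩, fun _ hx => absurd hx (notMem_empty _)⟩

theorem levelSet_zero_eq_empty {f : E 0 → ℝ} (hM₀ : M 0 f = 1) : levelSet f 0 = ∅ := by
  refine eq_empty_of_forall_notMem fun x hx => ?_
  have : M 0 f ≤ 0 := M_le fun y _ => by
    rw [derivNorm_zero, Subsingleton.elim y x, hx.2, abs_zero]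
  linarith

end Main

end

end SmoothRigidity

theorem theorem7p2 (n d : ℕ) (hd : 1 ≤ d)
    (f : SmoothRigidity.E n → ℝ)
    (hf : ContDiffOn ℝ ((d + 1 : ℕ) : WithTop ℕ∞) f (SmoothRigidity.B n))
    (hM₀ : SmoothRigidity.M 0 f = 1)
    (hhalf : ∀ x ∈ SmoothRigidity.B n, f x = 0 → ‖x‖ ≤ 1 / 2)
    (γ : ℝ) (hγ₀ : 0 < γ) (hγ₁ : γ < 1)
    (hreg : SmoothRigidity.IsRegularValue γ f 0)
    (hiso : ¬ ∃ (P : MvPolynomial (Fin n) ℝ) (W : Set (SmoothRigidity.E n)),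
      P.totalDegree ≤ d ∧ SmoothRigidity.IsUnionOfSmoothComponents P W ∧
        SmoothRigidity.AreIsotopic d (SmoothRigidity.levelSet f 0) W) :
    SmoothRigidity.T n d γ ≤ SmoothRigidity.M (d + 1) f := by
  by_contra! hT
  refine hiso ?_
  -- With no coordinate function, `1 ≤ Cbar` is unavailable; but `B^0` is a single point, where `|f|
  -- = 1`, so the level set is empty.
  rcases eq_or_ne n 0 with rfl | hn
  · refine ⟨0, ∅, by simp, SmoothRigidity.isUnionOfSmoothComponents_empty 0, ?_⟩
    rw [SmoothRigidity.levelSet_zero_eq_empty hM₀]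
    exact SmoothRigidity.areIsotopic_empty d
  · obtain ⟨Q, hQ, hQf⟩ := SmoothRigidity.exists_polyFun_eq_taylorPoly f d
    have H := SmoothRigidity.normallyClose_taylorPoly hd hn hf hM₀ hhalf hγ₀ hγ₁ hreg hT
    rw [← hQf] at H
    obtain ⟨W, hW, hiso'⟩ := H.exists_isotopic_union hf.continuousOn
    exact ⟨Q, W, hQ, hW, hiso'⟩
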